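/- Let $n,m\ge 1$ be integers and let $\Psi=(\psi_1,\dots,\psi_m)$ with $\psi_j:\mathbb Z^n\to\mathbb R_{\ge 0}$ for $1\le j\le m$. Write $|\mathbf q|=\max_{1\le i\le n}|q_i|$ for $\mathbf q\in\mathbb Z^n$, let $\|t\|$ be the distance from $t\in\mathbb R$ to the nearest integer, and let $$W(n,m;\Psi)=\Big\{(\mathbf x_1,\dots,\mathbf x_m)\in([0,1]^n)^m:\ \|\mathbf q\cdot\mathbf x_j\|<\psi_j(\mathbf q)\ \text{for all } 1\le j\le m,\ \text{for infinitely many } \mathbf q\in\mathbb Z^n\Big\}.$$ Suppose that there are $\alpha\in\mathbb R$ and $c>0$ such that for all integers $0<q_1<q_2$, $$q_1^{\alpha}\sum_{\mathbf q\in\mathbb Z^n:\,|\mathbf q|=q_1}\ \prod_{j=1}^m\psi_j(\mathbf q)\ \ge\ c\,q_2^{\alpha}\sum_{\mathbf q\in\mathbb Z^n:\,|\mathbf q|=q_2}\ \prod_{j=1}^m\psi_j(\mathbf q).$$ Then, with $\mathcal L^{nm}$ denoting $nm$-dimensional Lebesgue measure: * if $\sum_{\mathbf q\in\mathbb Z^n}\prod_{j=1}^m\psi_j(\mathbf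 q)<\infty$, then $\mathcal L^{nm}(W(n,m;\Psi))=0$; * if $\sum_{\mathbf q\in\mathbb Z^n}\prod_{j=1}^m\psi_j(\mathbf q)=\infty$ and, in case $m\ge 2$, the functions $\psi_1,\dots,\psi_m$ are bounded, then $\mathcal L^{nm}(W(n,m;\Psi))=1$. -/

import Mathlib

open scoped NNReal ENNReal

namespace WeightedApprox

/-- The distance of a real number to the nearest integer. -/
noncomputable def distInt (t : ℝ) : ℝ := |t - round t|

/-- The maximum norm `|q| = max |q_i|` of an integer vector. -/
def supNorm {n : ℕ} (q : Fin n → ℤ) : ℕ := Finset.univ.sup fun i => (q i).natAbs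

/-- The finite set of integer vectors of maximum norm exactly `k`. -/
noncomputable def sphere (n k : ℕ) : Finset (Fin n → ℤ) :=
  (Fintype.piFinset fun _ : Fin n => Finset.Icc (-(k : ℤ)) (k : ℤ)).filter fun q => supNorm q = k

theorem mem_sphere {n k : ℕ} {q : Fin n → ℤ} : q ∈ sphere n k ↔ supNorm q = k := by
  simp only [sphere, Finset.mem_filter, Fintype.mem_piFinset, Finset.mem_Icc, and_iff_right_iff_imp]
  intro h i
  have : (q i).natAbs ≤ k := h ▸ Finset.le_sup (f := fun i => (q i).natAbs) (Finset.mem_univ i)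
  omega

/-- The set `W(n,m;Ψ)` of all `x = (x_1,…,x_m)`, with columns `x_j ∈ [0,1]^n`, such that
`‖q · x_j‖ < ψ_j(q)` for all `j` holds for infinitely many integer vectors `q`. -/
def W {n m : ℕ} (ψ : Fin m → (Fin n → ℤ) → ℝ≥0) : Set (Fin m → Fin n → ℝ) :=
  {x | (∀ j i, x j i ∈ Set.Icc (0 : ℝ) 1) ∧
    {q : Fin n → ℤ | ∀ j, distInt (∑ i, (q i : ℝ) * x j i) < ψ j q}.Infinite}

/-- The sum of `∏ j, ψ_j(q)` over the integer vectors `q` of maximum norm `k`. -/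
noncomputable def sphereSum {n m : ℕ} (ψ : Fin m → (Fin n → ℤ) → ℝ≥0) (k : ℕ) : ℝ≥0 :=
  ∑ q ∈ sphere n k, ∏ j, ψ j q

/-- Near-monotonicity: for some real `α`, `q₁ ^ α * S(q₁) ≫ q₂ ^ α * S(q₂)` for all
`0 < q₁ < q₂`, where `S` is `sphereSum ψ` and the implied constant is uniform in `q₁, q₂`. -/
def NearlyMonotone {n m : ℕ} (ψ : Fin m → (Fin n → ℤ) → ℝ≥0) : Prop :=
  ∃ α : ℝ, ∃ c : ℝ, 0 < c ∧ ∀ q₁ q₂ : ℕ, 0 < q₁ → q₁ < q₂ →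
    c * ((q₂ : ℝ) ^ α * (sphereSum ψ q₂ : ℝ)) ≤ (q₁ : ℝ) ^ α * (sphereSum ψ q₁ : ℝ)

end WeightedApprox

open MeasureTheory Metric Set Filter Topology

namespace WeightedApprox

/-! The conditions depend only on the `x_j` modulo 1, so everything takes place on the torus
(`volume_W`). For `q ≠ 0` the set belonging to `q` has measure at most `2 ^ m * ∏ ψ_j(q)`, and the
convergence half is the Borel–Cantelli lemma.

For divergence each set is shrunk to a reduced one: if `q = g p` with `p` primitive, then `p · x_j`
must lie near a fraction of exact denominator `g`. Reduced sets of `q` and `q' ≠ ±q` are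
quasi-independent (`volume_reducedSet_inter_le`): non-parallel forms are independent, and parallel
ones lead to fractions with different exact denominators. The price is a factor `(φ(g)/g)^m`, at
least `(φ(|q|)/|q|)^m` because `g` divides `|q|`. Now `φ(k)/k` is bounded below on average over the
blocks `(4^i, 4^(i+1)]`, and near-monotonicity bounds each sphere sum by those of the preceding
block, so the measures still have divergent sum (`exists_sum_le_sum_totient_mul`). A second-moment
Borel–Cantelli lemma (`measure_infinite_pos`) gives a limsup set of positive measure.

Full measure follows from a zero-one law. The map `x ↦ 2x` is ergodic and sends the limsup set of
`ψ` into that of `2ψ`, which for bounded `ψ` is the same up to a null set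
(`limsupSet_two_mul_ae_eq`). For `m = 1` an unbounded `ψ` makes the limsup set the whole torus. -/

/-! ### Reduced fractions on the circle -/

theorem volume_ball_circle (x : UnitAddCircle) (ε : ℝ) :
    volume (ball x ε) = ENNReal.ofReal (min 1 (2 * ε)) := by
  rw [← AddCircle.volume_closedBall (T := 1), measure_congr AddCircle.closedBall_ae_eq_ball]

theorem volume_ball_circle_le (x : UnitAddCircle) (ε : ℝ) :
    volume (ball x ε) ≤ ENNReal.ofReal (2 * ε) := by
  rw [volume_ball_circle]
  exact ENNReal.ofReal_le_ofReal (min_le_right _ _)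

/-- The number of nonzero integers of absolute value less than `Y` is at most `2 * Y`. -/
theorem card_filter_abs_lt_le (s : Finset ℤ) (Y : ℝ) (hY : 0 ≤ Y)
    (h0 : ∀ z ∈ s, z ≠ 0) (hs : ∀ z ∈ s, |(z : ℝ)| < Y) : (s.card : ℝ) ≤ 2 * Y := by
  have hsub : s ⊆ (Finset.Icc (-⌊Y⌋) ⌊Y⌋).erase 0 := by
    intro z hz
    have h1 := abs_lt.1 (hs z hz)
    rw [Finset.mem_erase, Finset.mem_Icc]
    refine ⟨h0 z hz, ?_, Int.le_floor.2 h1.2.le⟩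
    have : -z ≤ ⌊Y⌋ := Int.le_floor.2 (by push_cast; linarith)
    linarith
  have hf : 0 ≤ ⌊Y⌋ := Int.floor_nonneg.2 hY
  have hc : (s.card : ℤ) ≤ 2 * ⌊Y⌋ := by
    have := Finset.card_le_card hsub
    rw [Finset.card_erase_of_mem (by simp [hf]), Int.card_Icc] at this
    omega
  have h2 : (s.card : ℝ) ≤ 2 * (⌊Y⌋ : ℝ) := by exact_mod_cast hc
  linarith [Int.floor_le Y]

/-- There are at most `2 * X` pairs `(i, k)`, `0 ≤ i < a`, with `0 < |i * b - k * a| < X`. -/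
theorem card_close_pairs_le {a b : ℕ} (ha : 0 < a) (hb : 0 < b) {X : ℝ} (hX : 0 ≤ X)
    (P : Finset (ℕ × ℤ)) (hi : ∀ p ∈ P, p.1 < a)
    (h0 : ∀ p ∈ P, (p.1 : ℤ) * b - p.2 * a ≠ 0)
    (hlt : ∀ p ∈ P, |((((p.1 : ℤ) * b - p.2 * a : ℤ)) : ℝ)| < X) : (P.card : ℝ) ≤ 2 * X := by
  obtain ⟨d, a', b', hd, hcop, rfl, rfl⟩ := Nat.exists_coprime' (m := a) (n := b)
    (Nat.gcd_pos_of_pos_left _ ha)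
  have ha' : 0 < a' := Nat.pos_of_mul_pos_right ha
  have hdR : (0 : ℝ) < d := by exact_mod_cast hd
  let s : ℕ × ℤ → ℤ := fun p => (p.1 : ℤ) * b' - p.2 * a'
  have hs : ∀ p : ℕ × ℤ, (p.1 : ℤ) * (b' * d : ℕ) - p.2 * (a' * d : ℕ) = d * s p := by
    intro p; simp only [s]; push_cast; ring
  let S : Finset ℤ := P.image s
  have hS : (S.card : ℝ) ≤ 2 * (X / d) := by
    refine card_filter_abs_lt_le S _ (by positivity) ?_ ?_
    · intro z hz
      obtain ⟨p, hp, rfl⟩ := Finset.mem_image.1 hz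
      have := h0 p hp
      rw [hs] at this
      exact right_ne_zero_of_mul this
    · intro z hz
      obtain ⟨p, hp, rfl⟩ := Finset.mem_image.1 hz
      have := hlt p hp
      rw [hs] at this
      push_cast at this
      rw [abs_mul, abs_of_pos hdR] at this
      rwa [lt_div_iff₀' hdR]
  have hcard : P.card ≤ (S ×ˢ Finset.range d).card := by
    -- The value `i * b' - k * a'` fixes `i` modulo `a'`, the quotient `i / a' < d` then fixes `i`,
    -- and finally `k`. So each of the at most `2 * (X / d)` values is taken at most `d` times.
    refine Finset.card_le_card_of_injOn (fun p => (s p, p.1 / a')) ?_ ?_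
    · intro p hp
      simp only [Finset.coe_product, Set.mem_prod, Finset.mem_coe, Finset.mem_range]
      refine ⟨Finset.mem_image_of_mem _ hp, ?_⟩
      rw [Nat.div_lt_iff_lt_mul ha', mul_comm]
      exact hi p hp
    · rintro ⟨i, k⟩ hp ⟨i', k'⟩ hp' h
      simp only [Prod.mk.injEq, s] at h
      obtain ⟨h1, h2⟩ := h
      have h3 : (a' : ℤ) ∣ ((i : ℤ) - i') * b' := ⟨k - k', by linarith⟩
      have h4 : (a' : ℤ) ∣ (i : ℤ) - i' := by
        refine IsCoprime.dvd_of_dvd_mul_right ?_ h3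
        exact Nat.isCoprime_iff_coprime.2 hcop
      have h5 : i' ≡ i [MOD a'] := (Nat.modEq_iff_dvd).2 h4
      have h6 : i = i' := by
        rw [← Nat.div_add_mod i a', ← Nat.div_add_mod i' a', h2, h5]
      subst h6
      have h7 : k * a' = k' * a' := by linarith
      have h8 : k = k' := mul_right_cancel₀ (by exact_mod_cast ha'.ne') h7
      rw [h8]
  have hcardR : (P.card : ℝ) ≤ (S.card : ℝ) * d := by
    rw [Finset.card_product, Finset.card_range] at hcard
    exact_mod_cast hcard
  calc (P.card : ℝ) ≤ S.card * d := hcardR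
    _ ≤ 2 * (X / d) * d := by gcongr
    _ = 2 * X := by field_simp

/-- Neighbourhoods of the points of two different orders `a ≠ b` on the circle are
quasi-independent. -/
theorem volume_approxAddOrderOf_inter_le {a b : ℕ} (ha : 0 < a) (hb : 0 < b) (hab : a ≠ b)
    {δ ε : ℝ} (hδ : 0 ≤ δ) (hε : 0 ≤ ε) :
    volume (approxAddOrderOf UnitAddCircle a (δ / a) ∩ approxAddOrderOf UnitAddCircle b (ε / b))
      ≤ ENNReal.ofReal (8 * (δ * ε)) := by
  classical
  have haR : (0 : ℝ) < a := by exact_mod_cast ha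
  have hbR : (0 : ℝ) < b := by exact_mod_cast hb
  set X : ℝ := δ * b + ε * a with hXdef
  have hX : 0 ≤ X := by positivity
  -- The second entry is a numerator `k₀ ∈ [0, b)` shifted by `r * b` with `r ∈ {-1, 0, 1}`, which
  -- accounts for wrapping around the circle.
  let P : Finset (ℕ × ℤ) := (Finset.range a ×ˢ Finset.Icc (-(b : ℤ)) (2 * b)).filter fun p =>
    (p.1 : ℤ) * b - p.2 * a ≠ 0 ∧ |((((p.1 : ℤ) * b - p.2 * a : ℤ)) : ℝ)| < X
  have hP : (P.card : ℝ) ≤ 2 * X := by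
    refine card_close_pairs_le ha hb hX P ?_ ?_ ?_
    · intro p hp; simp only [P, Finset.mem_filter, Finset.mem_product, Finset.mem_range] at hp
      exact hp.1.1
    · intro p hp; exact (Finset.mem_filter.1 hp).2.1
    · intro p hp; exact (Finset.mem_filter.1 hp).2.2
  let B : ℕ × ℤ → Set UnitAddCircle := fun p =>
    ball ((((p.1 : ℝ) / a : ℝ)) : UnitAddCircle) (δ / a) ∩
      ball ((((p.2 : ℝ) / b : ℝ)) : UnitAddCircle) (ε / b)
  have hsub : approxAddOrderOf UnitAddCircle a (δ / a) ∩ approxAddOrderOf UnitAddCircle b (ε / b)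
      ⊆ ⋃ p ∈ P, B p := by
    rintro x ⟨hx1, hx2⟩
    obtain ⟨i, hia, hig, hx1⟩ := (UnitAddCircle.mem_approxAddOrderOf_iff ha).1 hx1
    obtain ⟨k₀, hkb, hkg, hx2⟩ := (UnitAddCircle.mem_approxAddOrderOf_iff hb).1 hx2
    have hd : ‖(((i : ℝ) / a - (k₀ : ℝ) / b : ℝ) : UnitAddCircle)‖ < δ / a + ε / b := by
      have : (((i : ℝ) / a - (k₀ : ℝ) / b : ℝ) : UnitAddCircle) =
          (x - (((k₀ : ℝ) / b : ℝ) : UnitAddCircle)) -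
            (x - (((i : ℝ) / a : ℝ) : UnitAddCircle)) := by
        rw [AddCircle.coe_sub]; abel
      rw [this]
      refine (norm_sub_le _ _).trans_lt ?_
      linarith
    rw [UnitAddCircle.norm_eq] at hd
    set r : ℤ := round ((i : ℝ) / a - (k₀ : ℝ) / b) with hr
    have hi1 : (i : ℝ) / a < 1 := (div_lt_one haR).2 (by exact_mod_cast hia)
    have hk1 : (k₀ : ℝ) / b < 1 := (div_lt_one hbR).2 (by exact_mod_cast hkb)
    have hi0 : 0 ≤ (i : ℝ) / a := by positivity
    have hk0 : 0 ≤ (k₀ : ℝ) / b := by positivity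
    have hrl := abs_le.1 (abs_sub_round ((i : ℝ) / a - (k₀ : ℝ) / b))
    rw [← hr] at hrl
    have hr1 : r < 2 := by
      have : (r : ℝ) < 2 := by linarith
      exact_mod_cast this
    have hr2 : -2 < r := by
      have : (-2 : ℝ) < r := by linarith
      exact_mod_cast this
    have key : ((i : ℝ) / a - (k₀ : ℝ) / b - r) * (a * b) =
        (((i : ℤ) * b - (k₀ + r * b) * a : ℤ) : ℝ) := by
      push_cast; field_simp; ring
    have hlt : |(((i : ℤ) * b - (k₀ + r * b) * a : ℤ) : ℝ)| < X := by
      rw [← key, abs_mul, abs_of_pos (mul_pos haR hbR)]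
      calc _ < (δ / a + ε / b) * (a * b) := by gcongr
        _ = X := by rw [hXdef]; field_simp
    -- This is where reduced fractions matter: equality would force `a ∣ b` and `b ∣ a`.
    have hne : (i : ℤ) * b - (k₀ + r * b) * a ≠ 0 := by
      intro h
      have h1 : (a : ℤ) ∣ (i : ℤ) * b := ⟨k₀ + r * b, by linarith⟩
      have h2 : (b : ℤ) ∣ (k₀ : ℤ) * a := ⟨i - r * a, by linarith⟩
      have h1' : a ∣ i * b := by exact_mod_cast h1
      have h2' : b ∣ k₀ * a := by exact_mod_cast h2
      have h3 : a ∣ b := Nat.Coprime.dvd_of_dvd_mul_left (Nat.Coprime.symm hig) h1'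
      have h4 : b ∣ a := Nat.Coprime.dvd_of_dvd_mul_left (Nat.Coprime.symm hkg) h2'
      exact hab (Nat.dvd_antisymm h3 h4)
    simp only [mem_iUnion]
    refine ⟨(i, k₀ + r * b), ?_, ?_⟩
    · simp only [P, Finset.mem_filter, Finset.mem_product, Finset.mem_range, Finset.mem_Icc]
      refine ⟨⟨hia, ?_, ?_⟩, hne, hlt⟩
      · nlinarith
      · nlinarith
    · refine ⟨by rwa [mem_ball, dist_eq_norm], ?_⟩
      rw [mem_ball, dist_eq_norm]
      have : ((((k₀ + r * b : ℤ) : ℝ) / b : ℝ) : UnitAddCircle) =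
          (((k₀ : ℝ) / b : ℝ) : UnitAddCircle) := by
        have : (((k₀ + r * b : ℤ) : ℝ) / b : ℝ) = (k₀ : ℝ) / b + (r : ℝ) := by
          push_cast; field_simp
        rw [this, AddCircle.coe_add]
        have h0 : ((r : ℝ) : UnitAddCircle) = 0 := by
          rw [AddCircle.coe_eq_zero_iff]; exact ⟨r, by simp⟩
        rw [h0, add_zero]
      rw [this]; exact hx2
  have hB : ∀ p ∈ P, volume (B p) ≤ ENNReal.ofReal (min (2 * (δ / a)) (2 * (ε / b))) := by
    intro p _
    rw [ENNReal.ofReal_min]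
    exact le_min ((measure_mono inter_subset_left).trans (volume_ball_circle_le _ _))
      ((measure_mono inter_subset_right).trans (volume_ball_circle_le _ _))
  calc _ ≤ volume (⋃ p ∈ P, B p) := measure_mono hsub
    _ ≤ ∑ p ∈ P, volume (B p) := measure_biUnion_finset_le _ _
    _ ≤ P.card • ENNReal.ofReal (min (2 * (δ / a)) (2 * (ε / b))) := Finset.sum_le_card_nsmul _ _ _ hB
    _ = ENNReal.ofReal (P.card * min (2 * (δ / a)) (2 * (ε / b))) := by
      rw [ENNReal.ofReal_mul (by positivity), ENNReal.ofReal_natCast, nsmul_eq_mul]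
    _ ≤ ENNReal.ofReal (8 * (δ * ε)) := by
      refine ENNReal.ofReal_le_ofReal ?_
      -- Each of the two terms of `X` is paired with the entry of the minimum whose denominator it
      -- cancels; each pair contributes `4 * (δ * ε)`.
      set μ := min (2 * (δ / a)) (2 * (ε / b))
      have hμ : 0 ≤ μ := by positivity
      have h1 : μ ≤ 2 * (δ / a) := min_le_left _ _
      have h2 : μ ≤ 2 * (ε / b) := min_le_right _ _
      calc P.card * μ ≤ 2 * X * μ := by gcongr
        _ = 2 * (δ * b * μ) + 2 * (ε * a * μ) := by rw [hXdef]; ring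
        _ ≤ 2 * (δ * b * (2 * (ε / b))) + 2 * (ε * a * (2 * (δ / a))) := by gcongr
        _ = 8 * (δ * ε) := by field_simp; ring

/-- Distinct fractions with denominator `a` are at least `1 / a` apart on the circle, so for `δ ≤ 1
/ 2` the `φ(a)` balls are disjoint. -/
theorem le_volume_approxAddOrderOf {a : ℕ} (ha : 0 < a) {δ : ℝ} (hδ : 0 ≤ δ) (hδ' : δ ≤ 1 / 2) :
    ENNReal.ofReal (a.totient / a * δ) ≤
      volume (approxAddOrderOf UnitAddCircle a (δ / a)) := by
  classical
  have haR : (0 : ℝ) < a := by exact_mod_cast ha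
  let F : Finset ℕ := (Finset.range a).filter fun i => a.Coprime i
  have hF : F.card = a.totient := (Nat.totient_eq_card_coprime a).symm
  let B : ℕ → Set UnitAddCircle := fun i => ball ((((i : ℝ) / a : ℝ)) : UnitAddCircle) (δ / a)
  have hsub : (⋃ i ∈ F, B i) ⊆ approxAddOrderOf UnitAddCircle a (δ / a) := by
    intro x hx
    simp only [mem_iUnion, F, Finset.mem_filter, Finset.mem_range] at hx
    obtain ⟨i, ⟨hia, hic⟩, hx⟩ := hx
    rw [UnitAddCircle.mem_approxAddOrderOf_iff ha]
    exact ⟨i, hia, hic.symm, by rwa [mem_ball, dist_eq_norm] at hx⟩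
  have hdisj : (F : Set ℕ).PairwiseDisjoint B := by
    intro i hi k hk hik
    rw [Function.onFun, Set.disjoint_left]
    intro x hxi hxk
    simp only [F, Finset.coe_filter, Finset.mem_range, mem_ofPred_eq] at hi hk
    simp only [B, mem_ball] at hxi hxk
    have hd : ‖(((i : ℝ) / a - (k : ℝ) / a : ℝ) : UnitAddCircle)‖ < 1 / a := by
      have h1 := dist_triangle_left ((((i : ℝ) / a : ℝ)) : UnitAddCircle)
        ((((k : ℝ) / a : ℝ)) : UnitAddCircle) x
      rw [dist_eq_norm, ← AddCircle.coe_sub] at h1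
      have h2 : δ / a + δ / a ≤ 1 / a := by rw [← add_div]; gcongr; linarith
      linarith
    rw [UnitAddCircle.norm_eq] at hd
    set r : ℤ := round ((i : ℝ) / a - (k : ℝ) / a) with hr
    have key : ((i : ℝ) / a - (k : ℝ) / a - r) * a = (((i : ℤ) - k - r * a : ℤ) : ℝ) := by
      push_cast; field_simp
    have hlt : |(((i : ℤ) - k - r * a : ℤ) : ℝ)| < 1 := by
      rw [← key, abs_mul, abs_of_pos haR]
      rwa [lt_div_iff₀ haR] at hd
    have hz : (i : ℤ) - k - r * a = 0 := by
      rw [← Int.abs_lt_one_iff]; exact_mod_cast hlt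
    have hm : k ≡ i [MOD a] := Nat.modEq_iff_dvd.2 ⟨r, by linarith⟩
    exact hik (Nat.ModEq.eq_of_lt_of_lt hm hk.1 hi.1).symm
  calc ENNReal.ofReal (a.totient / a * δ) ≤ ENNReal.ofReal (F.card * min 1 (2 * (δ / a))) := by
        refine ENNReal.ofReal_le_ofReal ?_
        rw [hF, div_mul_eq_mul_div, mul_div_assoc]
        gcongr
        have h0 : 0 ≤ δ / a := by positivity
        have h1 : δ / a ≤ 1 := (div_le_one haR).2
          (by have : (1 : ℝ) ≤ a := by exact_mod_cast ha
              linarith)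
        exact le_min h1 (by linarith)
    _ = ∑ i ∈ F, volume (B i) := by
        simp only [B, volume_ball_circle, Finset.sum_const]
        rw [ENNReal.ofReal_mul (by positivity), ENNReal.ofReal_natCast, nsmul_eq_mul]
    _ = volume (⋃ i ∈ F, B i) :=
        (measure_biUnion_finset hdisj fun i _ => measurableSet_ball).symm
    _ ≤ _ := measure_mono hsub

theorem neg_mem_approxAddOrderOf {a : ℕ} {δ : ℝ} {x : UnitAddCircle}
    (hx : x ∈ approxAddOrderOf UnitAddCircle a δ) : -x ∈ approxAddOrderOf UnitAddCircle a δ := by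
  rw [mem_approx_add_orderOf_iff] at hx ⊢
  obtain ⟨b, hb, hxb⟩ := hx
  refine ⟨-b, by rwa [addOrderOf_neg], ?_⟩
  rw [mem_ball, dist_neg_neg]
  exact hxb

theorem norm_nsmul_lt_of_mem_approxAddOrderOf {a : ℕ} (ha : 0 < a) {δ : ℝ} {x : UnitAddCircle}
    (hx : x ∈ approxAddOrderOf UnitAddCircle a (δ / a)) : ‖a • x‖ < δ := by
  rw [mem_approx_add_orderOf_iff] at hx
  obtain ⟨b, rfl, hxb⟩ := hx
  rw [mem_ball, dist_eq_norm] at hxb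
  have haR : (0 : ℝ) < addOrderOf b := by exact_mod_cast ha
  have : addOrderOf b • x = addOrderOf b • (x - b) := by
    rw [nsmul_sub, addOrderOf_nsmul_eq_zero, sub_zero]
  rw [this]
  calc _ ≤ addOrderOf b * ‖x - b‖ := norm_nsmul_le
    _ < addOrderOf b * (δ / addOrderOf b) := by gcongr
    _ = δ := by field_simp

/-! ### Integer linear forms on the torus -/

instance isProbabilityMeasure_volume_circle :
    IsProbabilityMeasure (volume : Measure UnitAddCircle) := ⟨UnitAddCircle.measure_univ⟩

instance isAddHaarMeasure_volume_matrix_torus (m n : ℕ) :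
    (volume : Measure (Fin m → Fin n → UnitAddCircle)).IsAddHaarMeasure :=
  Measure.pi.isAddHaarMeasure fun _ : Fin m => (volume : Measure (Fin n → UnitAddCircle))

instance borelSpace_matrix_torus (m n : ℕ) : BorelSpace (Fin m → Fin n → UnitAddCircle) :=
  Pi.borelSpace

variable {n m : ℕ}

/-- The linear form `x ↦ ∑ i, q i • x i` on the torus. -/
noncomputable def linForm (q : Fin n → ℤ) : (Fin n → UnitAddCircle) →+ UnitAddCircle where
  toFun x := ∑ i, q i • x i
  map_zero' := by simp
  map_add' x y := by simp [Finset.sum_add_distrib]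

theorem linForm_apply (q : Fin n → ℤ) (x : Fin n → UnitAddCircle) :
    linForm q x = ∑ i, q i • x i := rfl

theorem continuous_linForm (q : Fin n → ℤ) : Continuous (linForm q) := by
  change Continuous fun x : Fin n → UnitAddCircle => ∑ i, q i • x i
  fun_prop

theorem linForm_zsmul (c : ℤ) (q : Fin n → ℤ) (x : Fin n → UnitAddCircle) :
    linForm (c • q) x = c • linForm q x := by
  simp [linForm_apply, Finset.smul_sum, mul_smul]

theorem linForm_single (q : Fin n → ℤ) (k : Fin n) (t : UnitAddCircle) :
    linForm q (Pi.single k t) = q k • t := by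
  rw [linForm_apply, Finset.sum_eq_single k]
  · simp
  · intro i _ hi; simp [hi]
  · simp

theorem coe_zsmul_circle (c : ℤ) (t : ℝ) :
    c • (t : UnitAddCircle) = ((c * t : ℝ) : UnitAddCircle) := by
  rw [← AddCircle.coe_zsmul, zsmul_eq_mul]

theorem linForm_surjective {q : Fin n → ℤ} (hq : q ≠ 0) : Function.Surjective (linForm q) := by
  obtain ⟨k, hk⟩ := Function.ne_iff.1 hq
  intro t
  obtain ⟨t, rfl⟩ := QuotientAddGroup.mk_surjective t
  have hk' : (q k : ℝ) ≠ 0 := by exact_mod_cast hk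
  refine ⟨Pi.single k ((t / q k : ℝ) : UnitAddCircle), ?_⟩
  rw [linForm_single, coe_zsmul_circle, mul_div_cancel₀ _ hk']

/-- A continuous surjective homomorphism of compact groups carries Haar measure to Haar measure. -/
theorem measurePreserving_linForm {q : Fin n → ℤ} (hq : q ≠ 0) :
    MeasurePreserving (linForm q) volume volume :=
  (linForm q).measurePreserving (continuous_linForm q) (linForm_surjective hq) (by simp)

/-- A nonzero minor makes the pair of forms surjective, by Cramer's rule; hence non-parallel forms
are independent random variables. -/
theorem measurePreserving_linForm_prod {q q' : Fin n → ℤ} {i k : Fin n}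
    (h : q i * q' k - q k * q' i ≠ 0) :
    MeasurePreserving (fun x => (linForm q x, linForm q' x)) volume
      ((volume : Measure UnitAddCircle).prod (volume : Measure UnitAddCircle)) := by
  refine ((linForm q).prod (linForm q')).measurePreserving
    ((continuous_linForm q).prodMk (continuous_linForm q')) ?_ (by simp only [measure_univ])
  rintro ⟨s, t⟩
  obtain ⟨s, rfl⟩ := QuotientAddGroup.mk_surjective s
  obtain ⟨t, rfl⟩ := QuotientAddGroup.mk_surjective t
  have hD : (q i : ℝ) * q' k - q k * q' i ≠ 0 := by exact_mod_cast h
  set D : ℝ := (q i : ℝ) * q' k - q k * q' i with hDdef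
  refine ⟨Pi.single i (((s * q' k - t * q k) / D : ℝ) : UnitAddCircle) +
    Pi.single k (((t * q i - s * q' i) / D : ℝ) : UnitAddCircle), ?_⟩
  rw [map_add, AddMonoidHom.prod_apply, AddMonoidHom.prod_apply]
  simp only [linForm_single, coe_zsmul_circle, Prod.mk_add_mk]
  rw [← AddCircle.coe_add, ← AddCircle.coe_add]
  congr 2
  · field_simp; rw [hDdef]; ring
  · field_simp; rw [hDdef]; ring

theorem volume_linForm_norm_lt_le {q : Fin n → ℤ} (hq : q ≠ 0) (δ : ℝ) :
    volume {x | ‖linForm q x‖ < δ} ≤ ENNReal.ofReal (2 * δ) := by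
  have : {x | ‖linForm q x‖ < δ} = linForm q ⁻¹' ball 0 δ := by
    ext x; simp
  rw [this, (measurePreserving_linForm hq).measure_preimage measurableSet_ball.nullMeasurableSet]
  exact volume_ball_circle_le _ _

theorem volume_linForm_inter_le {q q' : Fin n → ℤ} {i k : Fin n}
    (h : q i * q' k - q k * q' i ≠ 0) {δ : ℝ} (hδ : 0 ≤ δ) (ε : ℝ) :
    volume ({x | ‖linForm q x‖ < δ} ∩ {x | ‖linForm q' x‖ < ε}) ≤
      ENNReal.ofReal (4 * (δ * ε)) := by
  have : {x | ‖linForm q x‖ < δ} ∩ {x | ‖linForm q' x‖ < ε} =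
      (fun x => (linForm q x, linForm q' x)) ⁻¹' (ball 0 δ ×ˢ ball 0 ε) := by
    ext x; simp
  rw [this, (measurePreserving_linForm_prod h).measure_preimage
    (measurableSet_ball.prod measurableSet_ball).nullMeasurableSet, Measure.prod_prod]
  calc _ ≤ ENNReal.ofReal (2 * δ) * ENNReal.ofReal (2 * ε) := by
        gcongr <;> exact volume_ball_circle_le _ _
    _ = _ := by
        rw [← ENNReal.ofReal_mul (by positivity)]; congr 1; ring

/-! ### Primitive parts and reduced strips -/

/-- The greatest common divisor of the entries of an integer vector. -/
def vecGcd (q : Fin n → ℤ) : ℕ := Finset.univ.gcd fun i => (q i).natAbs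

/-- The primitive vector in the direction of `q`. -/
def primPart (q : Fin n → ℤ) : Fin n → ℤ := fun i => q i / vecGcd q

theorem vecGcd_zsmul_primPart (q : Fin n → ℤ) : (vecGcd q : ℤ) • primPart q = q := by
  funext i
  have : (vecGcd q : ℤ) ∣ q i :=
    Int.natCast_dvd.2 (Finset.gcd_dvd (f := fun i => (q i).natAbs) (Finset.mem_univ i))
  simpa [primPart] using Int.mul_ediv_cancel' this

theorem vecGcd_pos {q : Fin n → ℤ} (hq : q ≠ 0) : 0 < vecGcd q := by
  refine Nat.pos_of_ne_zero fun h => hq ?_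
  rw [← vecGcd_zsmul_primPart q, h]; simp

theorem primPart_ne_zero {q : Fin n → ℤ} (hq : q ≠ 0) : primPart q ≠ 0 := fun h =>
  hq (by rw [← vecGcd_zsmul_primPart q, h, smul_zero])

theorem vecGcd_zsmul (c : ℤ) (q : Fin n → ℤ) : vecGcd (c • q) = c.natAbs * vecGcd q := by
  simp [vecGcd, Int.natAbs_mul, Finset.gcd_mul_left]

theorem vecGcd_primPart {q : Fin n → ℤ} (hq : q ≠ 0) : vecGcd (primPart q) = 1 := by
  have h := vecGcd_zsmul (vecGcd q) (primPart q)
  rw [vecGcd_zsmul_primPart, Int.natAbs_natCast] at h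
  exact (Nat.eq_of_mul_eq_mul_left (vecGcd_pos hq) (by rw [← h, mul_one])).symm

theorem vecGcd_dvd_supNorm (hn : 1 ≤ n) (q : Fin n → ℤ) : vecGcd q ∣ supNorm q := by
  have : Nonempty (Fin n) := ⟨⟨0, hn⟩⟩
  obtain ⟨i, _, hi⟩ := Finset.exists_mem_eq_sup Finset.univ Finset.univ_nonempty
    fun i => (q i).natAbs
  rw [supNorm, hi]
  exact Finset.gcd_dvd (Finset.mem_univ i)

/-- Parallel integer vectors have the same primitive part, up to sign. -/
theorem primPart_eq_or_eq_neg {q q' : Fin n → ℤ} (hq : q ≠ 0) (hq' : q' ≠ 0)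
    (h : ∀ i k, q i * q' k - q k * q' i = 0) :
    primPart q' = primPart q ∨ primPart q' = -primPart q := by
  obtain ⟨k, hk⟩ := Function.ne_iff.1 hq
  have e : q k • q' = q' k • q := by
    funext i; have := h i k; simp only [Pi.smul_apply, smul_eq_mul]; linarith
  rw [← vecGcd_zsmul_primPart q', ← vecGcd_zsmul_primPart q, smul_smul, smul_smul,
    vecGcd_zsmul_primPart, vecGcd_zsmul_primPart] at e
  set u := q k * vecGcd q' with hu
  set v := q' k * vecGcd q with hv
  have hu0 : u ≠ 0 := mul_ne_zero hk (by exact_mod_cast (vecGcd_pos hq').ne')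
  have hg : u.natAbs = v.natAbs := by
    have := congrArg vecGcd e
    rwa [vecGcd_zsmul, vecGcd_zsmul, vecGcd_primPart hq, vecGcd_primPart hq', mul_one,
      mul_one] at this
  rcases Int.natAbs_eq_natAbs_iff.1 hg with h1 | h1
  · left
    rw [← h1] at e
    exact smul_right_injective _ hu0 e
  · right
    have e' : u • primPart q' = u • (-primPart q) := by
      rw [e, h1, smul_neg, neg_smul, neg_neg]
    exact smul_right_injective _ hu0 e'

/-- The points whose image under the linear form `q` is close to an integer `r`, with `r` coprime
to the greatest common divisor of the entries of `q`. -/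
def reducedSet (q : Fin n → ℤ) (δ : ℝ) : Set (Fin n → UnitAddCircle) :=
  linForm (primPart q) ⁻¹' approxAddOrderOf UnitAddCircle (vecGcd q) (δ / vecGcd q)

theorem isOpen_approxAddOrderOf (a : ℕ) (δ : ℝ) : IsOpen (approxAddOrderOf UnitAddCircle a δ) :=
  isOpen_thickening

theorem isOpen_reducedSet (q : Fin n → ℤ) (δ : ℝ) : IsOpen (reducedSet q δ) :=
  isOpen_thickening.preimage (continuous_linForm _)

theorem reducedSet_subset {q : Fin n → ℤ} (hq : q ≠ 0) (δ : ℝ) :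
    reducedSet q δ ⊆ {x | ‖linForm q x‖ < δ} := by
  intro x hx
  have := norm_nsmul_lt_of_mem_approxAddOrderOf (vecGcd_pos hq) hx
  rw [mem_ofPred_eq, ← vecGcd_zsmul_primPart q, linForm_zsmul, natCast_zsmul]
  exact this

theorem le_volume_reducedSet {q : Fin n → ℤ} (hq : q ≠ 0) {δ : ℝ} (hδ : 0 ≤ δ) (hδ' : δ ≤ 1 / 2) :
    ENNReal.ofReal ((vecGcd q).totient / vecGcd q * δ) ≤ volume (reducedSet q δ) := by
  rw [reducedSet, (measurePreserving_linForm (primPart_ne_zero hq)).measure_preimage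
    (isOpen_approxAddOrderOf _ _).measurableSet.nullMeasurableSet]
  exact le_volume_approxAddOrderOf (vecGcd_pos hq) hδ hδ'

/-- Parallel vectors have the same primitive part up to sign, so excluding `q' = ±q` forces
different gcds, and the claim becomes the one for two different orders on the circle. Non-parallel
vectors give independent strips. -/
theorem volume_reducedSet_inter_le {q q' : Fin n → ℤ} (hq : q ≠ 0) (hq' : q' ≠ 0)
    (h1 : q ≠ q') (h2 : q ≠ -q') {δ ε : ℝ} (hδ : 0 ≤ δ) (hε : 0 ≤ ε) :
    volume (reducedSet q δ ∩ reducedSet q' ε) ≤ ENNReal.ofReal (8 * (δ * ε)) := by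
  by_cases h : ∀ i k, q i * q' k - q k * q' i = 0
  · have hp := primPart_eq_or_eq_neg hq hq' h
    have hg : vecGcd q ≠ vecGcd q' := by
      intro hg
      rcases hp with hp | hp
      · exact h1 (by rw [← vecGcd_zsmul_primPart q, ← vecGcd_zsmul_primPart q', hg, hp])
      · exact h2 (by
          rw [← vecGcd_zsmul_primPart q, ← vecGcd_zsmul_primPart q', hg, hp, smul_neg, neg_neg])
    have hr : reducedSet q' ε =
        linForm (primPart q) ⁻¹' approxAddOrderOf UnitAddCircle (vecGcd q') (ε / vecGcd q') := by
      rcases hp with hp | hp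
      · rw [reducedSet, hp]
      · have hneg : ∀ x, linForm (primPart q') x = -linForm (primPart q) x := by
          intro x
          rw [hp, ← neg_one_zsmul (primPart q), linForm_zsmul, neg_one_zsmul]
        ext x
        rw [reducedSet, mem_preimage, mem_preimage, hneg]
        exact ⟨fun hx => by simpa using neg_mem_approxAddOrderOf hx, neg_mem_approxAddOrderOf⟩
    rw [hr, reducedSet, ← preimage_inter,
      (measurePreserving_linForm (primPart_ne_zero hq)).measure_preimage
        ((isOpen_approxAddOrderOf _ _).inter (isOpen_approxAddOrderOf _ _)).measurableSet.nullMeasurableSet]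
    exact volume_approxAddOrderOf_inter_le (vecGcd_pos hq) (vecGcd_pos hq') hg hδ hε
  · push Not at h
    obtain ⟨i, k, hik⟩ := h
    refine (measure_mono (inter_subset_inter (reducedSet_subset hq δ)
      (reducedSet_subset hq' ε))).trans ((volume_linForm_inter_le hik hδ ε).trans ?_)
    refine ENNReal.ofReal_le_ofReal ?_
    have := mul_nonneg hδ hε
    linarith

/-! ### Approximation sets for all columns -/

/-- The set of `x = (x_1, …, x_m)` on the torus with `‖q · x_j‖ < ψ_j(q)` for all `j`. -/
def approxSet (ψ : Fin m → (Fin n → ℤ) → ℝ≥0) (q : Fin n → ℤ) :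
    Set (Fin m → Fin n → UnitAddCircle) :=
  {x | ∀ j, ‖linForm q (x j)‖ < ψ j q}

/-- The reduced version of `approxSet`. -/
def reducedApproxSet (ψ : Fin m → (Fin n → ℤ) → ℝ≥0) (q : Fin n → ℤ) :
    Set (Fin m → Fin n → UnitAddCircle) :=
  Set.univ.pi fun j => reducedSet q (ψ j q)

theorem isOpen_approxSet (ψ : Fin m → (Fin n → ℤ) → ℝ≥0) (q : Fin n → ℤ) :
    IsOpen (approxSet ψ q) := by
  have : approxSet ψ q = ⋂ j, {x | ‖linForm q (x j)‖ < ψ j q} := by ext; simp [approxSet]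
  rw [this]
  refine isOpen_iInter_of_finite fun j => isOpen_lt ?_ continuous_const
  exact ((continuous_linForm q).comp (continuous_apply j)).norm

theorem measurableSet_reducedApproxSet (ψ : Fin m → (Fin n → ℤ) → ℝ≥0) (q : Fin n → ℤ) :
    MeasurableSet (reducedApproxSet ψ q) :=
  (isOpen_set_pi Set.finite_univ fun _ _ => isOpen_reducedSet _ _).measurableSet

theorem reducedApproxSet_subset (ψ : Fin m → (Fin n → ℤ) → ℝ≥0) {q : Fin n → ℤ} (hq : q ≠ 0) :
    reducedApproxSet ψ q ⊆ approxSet ψ q :=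
  fun _ hx j => reducedSet_subset hq _ (hx j (mem_univ j))

theorem volume_approxSet_le (ψ : Fin m → (Fin n → ℤ) → ℝ≥0) {q : Fin n → ℤ} (hq : q ≠ 0) :
    volume (approxSet ψ q) ≤ 2 ^ m * ∏ j, (ψ j q : ℝ≥0∞) := by
  have : approxSet ψ q = Set.univ.pi fun j => {x | ‖linForm q x‖ < ψ j q} := by
    ext; simp [approxSet]
  rw [this, volume_pi_pi]
  calc _ ≤ ∏ j, (2 * (ψ j q : ℝ≥0∞)) := by
        refine Finset.prod_le_prod' fun j _ => (volume_linForm_norm_lt_le hq _).trans_eq ?_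
        rw [ENNReal.ofReal_mul (by norm_num), ENNReal.ofReal_coe_nnreal]; simp
    _ = _ := by simp [Finset.prod_mul_distrib]

theorem measureReal_reducedApproxSet_inter_le (ψ : Fin m → (Fin n → ℤ) → ℝ≥0) {q q' : Fin n → ℤ}
    (hq : q ≠ 0) (hq' : q' ≠ 0) (h1 : q ≠ q') (h2 : q ≠ -q') :
    volume.real (reducedApproxSet ψ q ∩ reducedApproxSet ψ q') ≤
      8 ^ m * ((∏ j, (ψ j q : ℝ)) * ∏ j, (ψ j q' : ℝ)) := by
  rw [reducedApproxSet, reducedApproxSet, ← Set.pi_inter_distrib, Measure.real, volume_pi_pi,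
    ENNReal.toReal_prod]
  calc _ ≤ ∏ j, (8 * ((ψ j q : ℝ) * ψ j q')) := by
        refine Finset.prod_le_prod (fun j _ => ENNReal.toReal_nonneg) fun j _ => ?_
        exact ENNReal.toReal_le_of_le_ofReal (by positivity)
          (volume_reducedSet_inter_le hq hq' h1 h2 (NNReal.coe_nonneg _) (NNReal.coe_nonneg _))
    _ = _ := by simp [Finset.prod_mul_distrib]

/-- By `φ(k)/k = ∏ (1 - 1/p)` over primes `p ∣ k`, a divisor has fewer factors. This replaces the
gcd of `q` by `supNorm q`, giving a weight constant on spheres. -/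
theorem totient_div_le_of_dvd {a k : ℕ} (hk : 0 < k) (h : a ∣ k) :
    (k.totient : ℝ) / k ≤ a.totient / a := by
  have key : ∀ l : ℕ, 0 < l →
      (l.totient : ℚ) / l = ∏ p ∈ l.primeFactors, (1 - (p : ℚ)⁻¹) := by
    intro l hl
    have : (l : ℚ) ≠ 0 := by exact_mod_cast hl.ne'
    rw [Nat.totient_eq_mul_prod_factors, mul_div_cancel_left₀ _ this]
  have hnn : ∀ p ∈ k.primeFactors, 0 ≤ 1 - (p : ℚ)⁻¹ := by
    intro p hp
    have : (1 : ℚ) ≤ p := by exact_mod_cast (Nat.prime_of_mem_primeFactors hp).one_le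
    exact sub_nonneg.2 (inv_le_one_of_one_le₀ this)
  have hsub := Nat.primeFactors_mono h hk.ne'
  have hQ : (k.totient : ℚ) / k ≤ a.totient / a := by
    rw [key k hk, key a (Nat.pos_of_dvd_of_pos h hk), ← Finset.prod_sdiff hsub]
    refine mul_le_of_le_one_left (Finset.prod_nonneg fun p hp => hnn p (hsub hp)) ?_
    refine Finset.prod_le_one (fun p hp => hnn p (Finset.mem_sdiff.1 hp).1) fun p _ => ?_
    exact sub_le_self _ (by positivity)
  have := (Rat.cast_le (K := ℝ)).2 hQ
  push_cast at this
  exact this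

theorem le_measureReal_reducedApproxSet (hn : 1 ≤ n) (ψ : Fin m → (Fin n → ℤ) → ℝ≥0)
    (hψ : ∀ j q, ψ j q ≤ 1 / 2) {q : Fin n → ℤ} (hq : q ≠ 0) :
    ((supNorm q).totient / supNorm q : ℝ) ^ m * ∏ j, (ψ j q : ℝ) ≤
      volume.real (reducedApproxSet ψ q) := by
  have hpos : 0 < supNorm q := by
    refine Nat.pos_of_ne_zero fun h => hq ?_
    funext i
    have : (q i).natAbs ≤ supNorm q :=
      Finset.le_sup (f := fun i => (q i).natAbs) (Finset.mem_univ i)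
    simp only [Pi.zero_apply]; omega
  rw [reducedApproxSet, Measure.real, volume_pi_pi, ENNReal.toReal_prod]
  calc _ = ∏ j, ((supNorm q).totient / supNorm q * (ψ j q : ℝ)) := by
        rw [Finset.prod_mul_distrib, Finset.prod_const, Finset.card_fin]
    _ ≤ _ := by
        refine Finset.prod_le_prod (fun j _ => by positivity) fun j _ => ?_
        refine (mul_le_mul_of_nonneg_right (totient_div_le_of_dvd hpos (vecGcd_dvd_supNorm hn q))
          (NNReal.coe_nonneg _)).trans ?_
        have h2 : (ψ j q : ℝ) ≤ 1 / 2 := by exact_mod_cast hψ j q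
        rw [← ENNReal.ofReal_le_iff_le_toReal (measure_ne_top _ _)]
        exact le_volume_reducedSet hq (NNReal.coe_nonneg _) h2

/-! ### Averages of the totient function -/

/-- Sum `k = ∑ φ(l)` over `l ∣ k` and exchange the summations: `N / l` counts the multiples of `l`.
-/
theorem sum_Ioc_totient_mul_div (N : ℕ) :
    ∑ l ∈ Finset.Ioc 0 N, l.totient * (N / l) = ∑ k ∈ Finset.Ioc 0 N, k := by
  have h1 : ∀ k ∈ Finset.Ioc 0 N, k = ∑ l ∈ Finset.Ioc 0 N, if l ∣ k then l.totient else 0 := by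
    intro k hk
    rw [Finset.mem_Ioc] at hk
    rw [← Finset.sum_filter]
    conv_lhs => rw [← Nat.sum_totient k]
    refine Finset.sum_congr ?_ fun _ _ => rfl
    ext d
    simp only [Nat.mem_divisors, Finset.mem_filter, Finset.mem_Ioc]
    constructor
    · rintro ⟨hd, _⟩
      exact ⟨⟨Nat.pos_of_dvd_of_pos hd hk.1, (Nat.le_of_dvd hk.1 hd).trans hk.2⟩, hd⟩
    · rintro ⟨_, hd⟩
      exact ⟨hd, hk.1.ne'⟩
  rw [Finset.sum_congr rfl h1, Finset.sum_comm]
  refine Finset.sum_congr rfl fun l _ => ?_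
  rw [← Finset.sum_filter, Finset.sum_const, Nat.Ioc_filter_dvd_card_eq_div, smul_eq_mul, mul_comm]

theorem two_mul_sum_Ioc_id (N : ℕ) : 2 * ∑ k ∈ Finset.Ioc 0 N, k = N * (N + 1) := by
  induction N with
  | zero => simp
  | succ N ih =>
    rw [Finset.sum_Ioc_succ_top (Nat.zero_le N), mul_add, ih]; ring

theorem le_sum_totient_div (N : ℕ) (hN : 0 < N) :
    ((N : ℝ) + 1) / 2 ≤ ∑ l ∈ Finset.Ioc 0 N, (l.totient : ℝ) / l := by
  have hNR : (0 : ℝ) < N := by exact_mod_cast hN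
  have h1 : (2 : ℝ) * ∑ l ∈ Finset.Ioc 0 N, (l.totient : ℝ) * ((N / l : ℕ) : ℝ) = N * (N + 1) := by
    have := two_mul_sum_Ioc_id N
    rw [← sum_Ioc_totient_mul_div] at this
    exact_mod_cast this
  have h2 : ∑ l ∈ Finset.Ioc 0 N, (l.totient : ℝ) * ((N / l : ℕ) : ℝ) ≤
      N * ∑ l ∈ Finset.Ioc 0 N, (l.totient : ℝ) / l := by
    rw [Finset.mul_sum]
    refine Finset.sum_le_sum fun l _ => ?_
    calc (l.totient : ℝ) * ((N / l : ℕ) : ℝ) ≤ l.totient * ((N : ℝ) / l) := by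
          gcongr; exact Nat.cast_div_le
      _ = _ := by ring
  refine le_of_mul_le_mul_left ?_ hNR
  linarith

theorem totient_div_le_one (l : ℕ) : (l.totient : ℝ) / l ≤ 1 :=
  div_le_one_of_le₀ (by exact_mod_cast Nat.totient_le l) (by positivity)

/-- The mean up to `4 ^ (i + 1)` gives more than `2 * 4 ^ i`, and the terms up to `4 ^ i` take away
at most `4 ^ i`. With blocks of ratio 2 this crude subtraction would leave almost nothing. -/
theorem le_sum_block_totient_div (i : ℕ) :
    (4 : ℝ) ^ i ≤ ∑ l ∈ Finset.Ioc (4 ^ i : ℕ) (4 ^ (i + 1)), (l.totient : ℝ) / l := by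
  have hle : 4 ^ i ≤ 4 ^ (i + 1) := Nat.pow_le_pow_right (by norm_num) (Nat.le_succ i)
  have h1 := le_sum_totient_div (4 ^ (i + 1)) (by positivity)
  have h2 := Finset.sum_Ioc_consecutive (fun l : ℕ => (l.totient : ℝ) / l) (Nat.zero_le (4 ^ i)) hle
  have h3 : ∑ l ∈ Finset.Ioc 0 (4 ^ i : ℕ), (l.totient : ℝ) / l ≤ (4 : ℝ) ^ i := by
    refine (Finset.sum_le_card_nsmul _ _ 1 fun l _ => totient_div_le_one l).trans_eq ?_
    simp
  push_cast [pow_succ] at h1 h2 ⊢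
  linarith

theorem card_block (i : ℕ) : (Finset.Ioc (4 ^ i : ℕ) (4 ^ (i + 1))).card = 3 * 4 ^ i := by
  rw [Nat.card_Ioc, pow_succ]; omega

/-- The mean of `φ(l)/l` over the `3 * 4 ^ i` elements of a block is at least `1 / 3`; the power
mean inequality passes to `m`-th powers. -/
theorem le_sum_block_totient_div_pow (m i : ℕ) :
    (4 : ℝ) ^ i / 3 ^ m ≤ ∑ l ∈ Finset.Ioc (4 ^ i : ℕ) (4 ^ (i + 1)), ((l.totient : ℝ) / l) ^ m := by
  cases m with
  | zero =>
    simp only [pow_zero, div_one, Finset.sum_const, card_block, nsmul_eq_mul, mul_one]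
    push_cast
    linarith [pow_pos (by norm_num : (0 : ℝ) < 4) i]
  | succ m =>
    refine le_trans ?_ (pow_sum_div_card_le_sum_pow (fun l _ => by positivity) m)
    rw [card_block]
    have h4 : (0 : ℝ) < 4 ^ i := by positivity
    have h := pow_le_pow_left₀ h4.le (le_sum_block_totient_div i) (m + 1)
    calc (4 : ℝ) ^ i / 3 ^ (m + 1) ≤ 4 ^ i / 3 ^ m := by
          gcongr <;> norm_num
      _ = ((4 : ℝ) ^ i) ^ (m + 1) / ((3 * 4 ^ i : ℕ) : ℝ) ^ m := by
          push_cast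
          rw [mul_pow, pow_succ ((4 : ℝ) ^ i) m]
          field_simp
      _ ≤ _ := by gcongr

/-- For a nearly monotone sequence, the weights `(φ(k)/k)^m` do not change the order of magnitude
of partial sums. -/
theorem exists_sum_le_sum_totient_mul {S : ℕ → ℝ} (hS : ∀ k, 0 ≤ S k) {α c : ℝ} (hc : 0 < c)
    (h : ∀ k₁ k₂ : ℕ, 0 < k₁ → k₁ < k₂ → c * ((k₂ : ℝ) ^ α * S k₂) ≤ (k₁ : ℝ) ^ α * S k₁) (m : ℕ) :
    ∃ K : ℝ, 0 < K ∧ ∀ I : ℕ, ∑ k ∈ Finset.Ioc 0 (4 ^ (I + 1) : ℕ), S k ≤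
      ∑ k ∈ Finset.Ioc 0 4, S k + K * ∑ k ∈ Finset.Ioc 0 (4 ^ I : ℕ),
        ((k.totient : ℝ) / k) ^ m * S k := by
  -- Elements of adjacent blocks have ratio at most 16, and the absolute value covers both signs of
  -- `α`.
  set C : ℝ := c⁻¹ * 16 ^ |α| with hC
  have hCpos : 0 < C := by positivity
  have hcomp : ∀ i : ℕ, ∀ k ∈ Finset.Ioc (4 ^ (i + 1) : ℕ) (4 ^ (i + 2)),
      ∀ l ∈ Finset.Ioc (4 ^ i : ℕ) (4 ^ (i + 1)), S k ≤ C * S l := by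
    intro i k hk l hl
    rw [Finset.mem_Ioc] at hk hl
    have hl0 : 0 < l := (pow_pos (by norm_num) i).trans hl.1
    have hlk : l < k := hl.2.trans_lt hk.1
    have hlR : (0 : ℝ) < l := by exact_mod_cast hl0
    have hkR : (0 : ℝ) < k := by exact_mod_cast hl0.trans hlk
    have h1 := h l k hl0 hlk
    have h2 : S k ≤ c⁻¹ * ((l : ℝ) / k) ^ α * S l := by
      rw [Real.div_rpow hlR.le hkR.le]
      have hka : (0 : ℝ) < (k : ℝ) ^ α := Real.rpow_pos_of_pos hkR α
      have : c⁻¹ * ((l : ℝ) ^ α / (k : ℝ) ^ α) * S l =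
          ((l : ℝ) ^ α * S l) / (c * (k : ℝ) ^ α) := by field_simp
      rw [this, le_div_iff₀ (by positivity)]
      linarith
    refine h2.trans (mul_le_mul_of_nonneg_right ?_ (hS l))
    rw [hC]
    gcongr
    have hkl : (k : ℝ) / l ≤ 16 := by
      rw [div_le_iff₀ hlR]
      have : k ≤ 16 * l := by
        calc k ≤ 4 ^ (i + 2) := hk.2
          _ = 16 * 4 ^ i := by ring
          _ ≤ 16 * l := by gcongr; exact hl.1.le
      exact_mod_cast this
    have hkl1 : 1 ≤ (k : ℝ) / l := (one_le_div hlR).2 (by exact_mod_cast hlk.le)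
    calc ((l : ℝ) / k) ^ α = ((k : ℝ) / l) ^ (-α) := by
          rw [Real.rpow_neg (by positivity), ← Real.inv_rpow (by positivity), inv_div]
      _ ≤ ((k : ℝ) / l) ^ |α| := Real.rpow_le_rpow_of_exponent_le hkl1 (neg_le_abs α)
      _ ≤ 16 ^ |α| := Real.rpow_le_rpow (by positivity) hkl (abs_nonneg α)
  set K : ℝ := 12 * C * 3 ^ m with hK
  refine ⟨K, by positivity, ?_⟩
  -- Each `S k` is compared with every `S l` of the preceding block, averaged with the weights,
  -- whose total there is at least `4 ^ i / 3 ^ m`. The 12 in `K` comes from the `3 * 4 ^ (i + 1)`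
  -- values of `k`.
  have hblock : ∀ i : ℕ, ∑ k ∈ Finset.Ioc (4 ^ (i + 1) : ℕ) (4 ^ (i + 2)), S k ≤
      K * ∑ l ∈ Finset.Ioc (4 ^ i : ℕ) (4 ^ (i + 1)), ((l.totient : ℝ) / l) ^ m * S l := by
    intro i
    set R := ∑ l ∈ Finset.Ioc (4 ^ i : ℕ) (4 ^ (i + 1)), ((l.totient : ℝ) / l) ^ m * S l with hR
    have h4 : (0 : ℝ) < 4 ^ i := by positivity
    have hk : ∀ k ∈ Finset.Ioc (4 ^ (i + 1) : ℕ) (4 ^ (i + 2)), S k ≤ C * 3 ^ m / 4 ^ i * R := by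
      intro k hk
      have h1 : (4 : ℝ) ^ i / 3 ^ m * S k ≤ C * R := by
        calc (4 : ℝ) ^ i / 3 ^ m * S k ≤
            (∑ l ∈ Finset.Ioc (4 ^ i : ℕ) (4 ^ (i + 1)), ((l.totient : ℝ) / l) ^ m) * S k :=
              mul_le_mul_of_nonneg_right (le_sum_block_totient_div_pow m i) (hS k)
          _ ≤ C * R := by
              rw [Finset.sum_mul, hR, Finset.mul_sum]
              refine Finset.sum_le_sum fun l hl => ?_
              calc _ ≤ ((l.totient : ℝ) / l) ^ m * (C * S l) := by
                    gcongr; exact hcomp i k hk l hl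
                _ = _ := by ring
      have h2 : S k = 3 ^ m / 4 ^ i * ((4 : ℝ) ^ i / 3 ^ m * S k) := by field_simp
      rw [h2]
      calc _ ≤ 3 ^ m / 4 ^ i * (C * R) := by gcongr
        _ = _ := by ring
    refine (Finset.sum_le_card_nsmul _ _ _ hk).trans_eq ?_
    rw [card_block, nsmul_eq_mul, hK]
    push_cast
    rw [pow_succ]
    field_simp
    ring
  have hsplit : ∀ (f : ℕ → ℝ) (i : ℕ), ∑ k ∈ Finset.Ioc 0 (4 ^ (i + 1)), f k =
      ∑ k ∈ Finset.Ioc 0 (4 ^ i : ℕ), f k + ∑ k ∈ Finset.Ioc (4 ^ i : ℕ) (4 ^ (i + 1)), f k := fun f i =>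
    (Finset.sum_Ioc_consecutive f (Nat.zero_le _)
      (Nat.pow_le_pow_right (by norm_num) (Nat.le_succ i))).symm
  intro I
  induction I with
  | zero =>
    have : 0 ≤ K * ∑ k ∈ Finset.Ioc 0 (4 ^ 0), ((k.totient : ℝ) / k) ^ m * S k :=
      mul_nonneg (by positivity)
        (Finset.sum_nonneg fun k _ => mul_nonneg (by positivity) (hS k))
    simpa using this
  | succ I ih =>
    rw [hsplit S (I + 1), hsplit (fun k => ((k.totient : ℝ) / k) ^ m * S k) I, mul_add, ← add_assoc]
    exact add_le_add ih (hblock I)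

/-! ### Limsup sets and the second moment method -/

theorem setOf_infinite_mem_eq {Ω ι : Type*} (A : ι → Set Ω) :
    {x | {i | x ∈ A i}.Infinite} = ⋂ G : Finset ι, ⋃ i ∉ G, A i := by
  ext x
  simp only [mem_ofPred_eq, mem_iInter, mem_iUnion]
  constructor
  · intro h G
    obtain ⟨i, hi, hiG⟩ := h.exists_notMem_finset G
    exact ⟨i, hiG, hi⟩
  · intro h hfin
    obtain ⟨i, hi, hx⟩ := h hfin.toFinset
    exact hi (hfin.mem_toFinset.2 hx)

theorem measurableSet_setOf_infinite_mem {Ω ι : Type*} [MeasurableSpace Ω] [Countable ι]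
    {A : ι → Set Ω} (hA : ∀ i, MeasurableSet (A i)) :
    MeasurableSet {x | {i | x ∈ A i}.Infinite} := by
  rw [setOf_infinite_mem_eq]
  exact .iInter fun G => .iUnion fun i => .iUnion fun _ => hA i

section SecondMoment

variable {Ω ι : Type*} [MeasurableSpace Ω] {μ : Measure Ω} [IsProbabilityMeasure μ]

/-- The Chung–Erdős inequality. -/
theorem sq_sum_measureReal_le {A : ι → Set Ω} (hA : ∀ i, MeasurableSet (A i)) (F : Finset ι) :
    (∑ i ∈ F, μ.real (A i)) ^ 2 ≤
      μ.real (⋃ i ∈ F, A i) * ∑ i ∈ F, ∑ j ∈ F, μ.real (A i ∩ A j) := by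
  set U : Set Ω := ⋃ i ∈ F, A i with hU
  have hUm : MeasurableSet U := F.measurableSet_biUnion fun i _ => hA i
  let e : Set Ω → Ω → ℝ := fun s => s.indicator 1
  have hint : ∀ s, MeasurableSet s → Integrable (e s) μ := fun s hs =>
    (integrable_const (1 : ℝ)).indicator hs
  have hval : ∀ s, MeasurableSet s → ∫ x, e s x ∂μ = μ.real s := fun s hs =>
    integral_indicator_one hs
  have hmul : ∀ s t x, e s x * e t x = e (s ∩ t) x := by
    intro s t x
    simp only [e, Set.inter_indicator_one, Pi.mul_apply]
  -- This is the integral of `(∑ 1_{A i} - t 1_U)²`; nonpositivity of its discriminant in `t` is the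
  -- claim.
  have hquad : ∀ t : ℝ, 0 ≤ μ.real U * (t * t) + (-2 * ∑ i ∈ F, μ.real (A i)) * t +
      ∑ i ∈ F, ∑ j ∈ F, μ.real (A i ∩ A j) := by
    intro t
    have hexp : ∀ x, (∑ i ∈ F, e (A i) x - t * e U x) ^ 2 =
        (∑ i ∈ F, ∑ j ∈ F, e (A i ∩ A j) x - (2 * t) * ∑ i ∈ F, e (A i) x) + (t * t) * e U x := by
      intro x
      have h1 : (∑ i ∈ F, e (A i) x) * (∑ j ∈ F, e (A j) x) =
          ∑ i ∈ F, ∑ j ∈ F, e (A i ∩ A j) x := by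
        simp_rw [Finset.sum_mul_sum, hmul]
      have h2 : (∑ i ∈ F, e (A i) x) * e U x = ∑ i ∈ F, e (A i) x := by
        rw [Finset.sum_mul]
        refine Finset.sum_congr rfl fun i hi => ?_
        rw [hmul, inter_eq_self_of_subset_left]
        exact subset_biUnion_of_mem (u := A) hi
      have h3 : e U x * e U x = e U x := by rw [hmul, inter_self]
      rw [← h1]
      linear_combination (-2 * t) * h2 + t ^ 2 * h3
    have h0 : 0 ≤ ∫ x, (∑ i ∈ F, e (A i) x - t * e U x) ^ 2 ∂μ :=
      integral_nonneg fun x => sq_nonneg _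
    have i1 : Integrable (fun x => ∑ i ∈ F, e (A i) x) μ :=
      integrable_finsetSum _ fun i _ => hint _ (hA i)
    have i2 : Integrable (fun x => ∑ i ∈ F, ∑ j ∈ F, e (A i ∩ A j) x) μ :=
      integrable_finsetSum _ fun i _ => integrable_finsetSum _ fun j _ =>
        hint _ ((hA i).inter (hA j))
    simp_rw [hexp] at h0
    have i3 : Integrable (fun x => (2 * t) * ∑ i ∈ F, e (A i) x) μ := i1.const_mul _
    have i4 : Integrable (fun x => ∑ i ∈ F, ∑ j ∈ F, e (A i ∩ A j) x -
      (2 * t) * ∑ i ∈ F, e (A i) x) μ := i2.sub i3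
    rw [integral_add i4 ((hint U hUm).const_mul _), integral_sub i2 i3, integral_const_mul, integral_const_mul,
      integral_finsetSum _ fun i _ => hint _ (hA i),
      integral_finsetSum _ fun i _ => integrable_finsetSum _ fun j _ =>
        hint _ ((hA i).inter (hA j)), hval U hUm] at h0
    simp_rw [fun i => integral_finsetSum (μ := μ) F (f := fun j x => e (A i ∩ A j) x)
      fun j _ => hint _ ((hA i).inter (hA j))] at h0
    simp_rw [fun i => hval _ (hA i), fun i j => hval _ ((hA i).inter (hA j))] at h0
    linarith
  have := discrim_le_zero hquad
  rw [discrim] at this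
  linarith

/-- A divergence Borel–Cantelli lemma for sets that are quasi-independent on average. -/
theorem measure_infinite_pos [Countable ι] {A : ι → Set Ω} (hA : ∀ i, MeasurableSet (A i))
    (σ : ι → ι) {f : ι → ℝ} (hf : ∀ i, 0 ≤ f i) {F : ℕ → Finset ι} {K c B : ℝ} (hK : 0 < K)
    (hc : 0 < c)
    (hAA : ∀ N, ∀ i ∈ F N, ∀ j ∈ F N, j ≠ i → j ≠ σ i → μ.real (A i ∩ A j) ≤ K * (f i * f j))
    (hlow : ∀ N, c * ∑ i ∈ F N, f i - B ≤ ∑ i ∈ F N, μ.real (A i))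
    (hdiv : ∀ R : ℝ, ∃ N, R ≤ ∑ i ∈ F N, f i) :
    0 < μ {x | {i | x ∈ A i}.Infinite} := by
  classical
  have key : ∀ G : Finset ι, c ^ 2 / (8 * K) ≤ μ.real (⋃ i ∉ G, A i) := by
    intro G
    -- The threshold ensures `a ≥ c * s / 2` after removing `G`, and `a ≥ 4`, so that the
    -- near-diagonal term `2 * a` is at most `a ^ 2 / 2`.
    obtain ⟨N, hN⟩ := hdiv (2 * (|B| + G.card + 4) / c)
    set s := ∑ i ∈ F N, f i with hs
    set H := F N \ G with hH
    set a := ∑ i ∈ H, μ.real (A i) with ha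
    set U := μ.real (⋃ i ∈ H, A i) with hU
    have hs0 : 0 ≤ s := Finset.sum_nonneg fun i _ => hf i
    have hU1 : U ≤ 1 := measureReal_le_one
    have hU0 : 0 ≤ U := measureReal_nonneg
    have hcs : 2 * (|B| + G.card + 4) ≤ c * s := by
      rw [div_le_iff₀ hc] at hN; linarith
    have ha1 : c * s - |B| - G.card ≤ a := by
      have h1 := hlow N
      have h2 : ∑ i ∈ F N, μ.real (A i) ≤ a + G.card := by
        calc ∑ i ∈ F N, μ.real (A i) ≤ ∑ i ∈ H ∪ G, μ.real (A i) := by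
              refine Finset.sum_le_sum_of_subset_of_nonneg ?_ fun _ _ _ => measureReal_nonneg
              rw [hH, Finset.sdiff_union_self_eq_union]
              exact Finset.subset_union_left
          _ = a + ∑ i ∈ G, μ.real (A i) := Finset.sum_union Finset.sdiff_disjoint
          _ ≤ a + G.card := by
              gcongr
              refine (Finset.sum_le_card_nsmul _ _ 1 fun i _ => measureReal_le_one).trans_eq ?_
              simp
      linarith [le_abs_self B]
    have hB0 := abs_nonneg B
    have hG0 : (0 : ℝ) ≤ G.card := by positivity
    have ha2 : c * s / 2 ≤ a := by linarith
    have ha4 : 4 ≤ a := by linarith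
    -- Only `j = i` and `j = σ i` escape quasi-independence, costing at most `2 * μ.real (A i)` for
    -- each `i`.
    have hpair : ∑ i ∈ H, ∑ j ∈ H, μ.real (A i ∩ A j) ≤ K * s ^ 2 + 2 * a := by
      have h1 : ∀ i ∈ H, ∑ j ∈ H, μ.real (A i ∩ A j) ≤ K * f i * s + 2 * μ.real (A i) := by
        intro i hi
        have hiF : i ∈ F N := (Finset.mem_sdiff.1 hi).1
        have h2 : ∀ j ∈ H, μ.real (A i ∩ A j) ≤ K * f i * f j +
            ((if j = i then μ.real (A i) else 0) + if j = σ i then μ.real (A i) else 0) := by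
          intro j hj
          have hjF : j ∈ F N := (Finset.mem_sdiff.1 hj).1
          have hle : μ.real (A i ∩ A j) ≤ μ.real (A i) := measureReal_mono inter_subset_left
          have hp : 0 ≤ K * f i * f j := mul_nonneg (mul_nonneg hK.le (hf i)) (hf j)
          have hp' : 0 ≤ μ.real (A i) := measureReal_nonneg
          by_cases h3 : j = i
          · rw [if_pos h3]; split_ifs <;> linarith
          · by_cases h4 : j = σ i
            · rw [if_neg h3, if_pos h4]; linarith
            · rw [if_neg h3, if_neg h4]
              have := hAA N i hiF j hjF h3 h4
              linarith
        refine (Finset.sum_le_sum h2).trans ?_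
        rw [Finset.sum_add_distrib, Finset.sum_add_distrib, ← Finset.mul_sum,
          Finset.sum_ite_eq', Finset.sum_ite_eq']
        have h5 : ∑ j ∈ H, f j ≤ s :=
          Finset.sum_le_sum_of_subset_of_nonneg Finset.sdiff_subset fun j _ _ => hf j
        have h6 : K * f i * ∑ j ∈ H, f j ≤ K * f i * s :=
          mul_le_mul_of_nonneg_left h5 (mul_nonneg hK.le (hf i))
        have hp' : 0 ≤ μ.real (A i) := measureReal_nonneg
        split_ifs <;> linarith
      refine (Finset.sum_le_sum h1).trans ?_
      rw [Finset.sum_add_distrib, ← Finset.mul_sum, ← Finset.sum_mul, ← Finset.mul_sum]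
      have h5 : ∑ j ∈ H, f j ≤ s :=
        Finset.sum_le_sum_of_subset_of_nonneg Finset.sdiff_subset fun j _ _ => hf j
      have h6 : K * (∑ j ∈ H, f j) * s ≤ K * s * s := by gcongr
      nlinarith
    have hCE : a ^ 2 ≤ U * (K * s ^ 2 + 2 * a) :=
      (sq_sum_measureReal_le hA H).trans (mul_le_mul_of_nonneg_left hpair hU0)
    have hmain : c ^ 2 / (8 * K) ≤ U := by
      have h1 : U * (2 * a) ≤ a ^ 2 / 2 := by nlinarith
      have h2 : (c * s) ^ 2 ≤ 4 * a ^ 2 := by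
        have : (c * s / 2) ^ 2 ≤ a ^ 2 := pow_le_pow_left₀ (by positivity) ha2 2
        linarith [this, show (c * s / 2) ^ 2 = (c * s) ^ 2 / 4 by ring]
      have hs1 : 0 < s := by
        by_contra hcon
        have : s = 0 := le_antisymm (not_lt.1 hcon) hs0
        rw [this, mul_zero] at hcs
        linarith
      have h3 : c ^ 2 * s ^ 2 ≤ U * (8 * K) * s ^ 2 := by nlinarith
      rw [div_le_iff₀ (by positivity)]
      exact le_of_mul_le_mul_right h3 (by positivity)
    refine hmain.trans (measureReal_mono ?_ (measure_ne_top _ _))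
    intro x hx
    simp only [mem_iUnion] at hx ⊢
    obtain ⟨i, hi, hx⟩ := hx
    exact ⟨i, (Finset.mem_sdiff.1 hi).2, hx⟩
  -- The lower bound does not depend on `G`, so it survives the decreasing intersection over finite
  -- sets.
  rw [setOf_infinite_mem_eq, Directed.measure_iInter]
  · have hpos : 0 < c ^ 2 / (8 * K) := by positivity
    refine (ENNReal.ofReal_pos.2 hpos).trans_le (le_iInf fun G => ?_)
    rw [ENNReal.ofReal_le_iff_le_toReal (measure_ne_top _ _)]
    exact key G
  · intro G
    exact (MeasurableSet.iUnion fun i => MeasurableSet.iUnion fun _ => hA i).nullMeasurableSet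
  · intro G G'
    refine ⟨G ∪ G', ?_, ?_⟩
    all_goals
      refine iUnion_mono fun i => iUnion_mono' fun hi => ⟨?_, subset_rfl⟩
      simp only [Finset.mem_union, not_or] at hi
      tauto
  · exact ⟨∅, measure_ne_top _ _⟩

end SecondMoment

/-! ### Positive measure in the divergence case -/

/-- The set of points on the torus lying in infinitely many `approxSet ψ q`. -/
def limsupSet (ψ : Fin m → (Fin n → ℤ) → ℝ≥0) : Set (Fin m → Fin n → UnitAddCircle) :=
  {x | {q | x ∈ approxSet ψ q}.Infinite}

theorem measurableSet_limsupSet (ψ : Fin m → (Fin n → ℤ) → ℝ≥0) : MeasurableSet (limsupSet ψ) :=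
  measurableSet_setOf_infinite_mem fun q => (isOpen_approxSet ψ q).measurableSet

theorem limsupSet_mono {ψ ψ' : Fin m → (Fin n → ℤ) → ℝ≥0} (h : ∀ j q, ψ j q ≤ ψ' j q) :
    limsupSet ψ ⊆ limsupSet ψ' := fun _ hx =>
  hx.mono fun q hq j => (hq j).trans_le (by exact_mod_cast h j q)

theorem natAbs_le_supNorm (q : Fin n → ℤ) (i : Fin n) : (q i).natAbs ≤ supNorm q :=
  Finset.le_sup (f := fun i => (q i).natAbs) (Finset.mem_univ i)

theorem supNorm_pos {q : Fin n → ℤ} : 0 < supNorm q ↔ q ≠ 0 := by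
  constructor
  · rintro h rfl
    simp [supNorm] at h
  · intro hq
    obtain ⟨i, hi⟩ := Function.ne_iff.1 hq
    exact (Int.natAbs_pos.2 hi).trans_le (natAbs_le_supNorm q i)

theorem sum_biUnion_sphere (s : Finset ℕ) (f : (Fin n → ℤ) → ℝ) :
    ∑ q ∈ s.biUnion (sphere n), f q = ∑ k ∈ s, ∑ q ∈ sphere n k, f q := by
  refine Finset.sum_biUnion fun k _ l _ hkl => Finset.disjoint_left.2 fun q hk hl => hkl ?_
  rw [mem_sphere] at hk hl
  rw [← hk, hl]

/-- In the divergence case the limsup set has positive measure. -/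
theorem volume_limsupSet_pos (hn : 1 ≤ n) {ψ : Fin m → (Fin n → ℤ) → ℝ≥0}
    (hmono : NearlyMonotone ψ) (hψ : ∀ j q, ψ j q ≤ 1 / 2)
    (hdiv : ∑' q : Fin n → ℤ, ∏ j, (ψ j q : ℝ≥0∞) = ∞) : 0 < volume (limsupSet ψ) := by
  classical
  obtain ⟨α, c, hc, h⟩ := hmono
  obtain ⟨K, hK, hsum⟩ := exists_sum_le_sum_totient_mul (S := fun k => (sphereSum ψ k : ℝ))
    (fun k => NNReal.coe_nonneg _) hc h m
  set f : (Fin n → ℤ) → ℝ := fun q => ∏ j, (ψ j q : ℝ) with hf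
  have hf0 : ∀ q, 0 ≤ f q := fun q => Finset.prod_nonneg fun j _ => NNReal.coe_nonneg _
  have hS : ∀ k, (sphereSum ψ k : ℝ) = ∑ q ∈ sphere n k, f q := by
    intro k; simp [sphereSum, hf]
  let F : ℕ → Finset (Fin n → ℤ) := fun I => (Finset.Ioc 0 (4 ^ (I + 1) : ℕ)).biUnion (sphere n)
  have hF : ∀ I, ∀ q ∈ F I, q ≠ 0 := by
    intro I q hq
    simp only [F, Finset.mem_biUnion, Finset.mem_Ioc, mem_sphere] at hq
    obtain ⟨k, hk, rfl⟩ := hq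
    exact supNorm_pos.1 hk.1
  set B₀ : ℝ := ∑ k ∈ Finset.Ioc 0 4, (sphereSum ψ k : ℝ)
  have hlow : ∀ I, K⁻¹ * ∑ q ∈ F I, f q - K⁻¹ * B₀ ≤
      ∑ q ∈ F I, volume.real (reducedApproxSet ψ q) := by
    intro I
    have h1 := hsum I
    simp_rw [hS] at h1
    rw [← sum_biUnion_sphere] at h1
    have h2 : ∑ k ∈ Finset.Ioc 0 (4 ^ I : ℕ), ((k.totient : ℝ) / k) ^ m * ∑ q ∈ sphere n k, f q ≤
        ∑ q ∈ F I, volume.real (reducedApproxSet ψ q) := by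
      rw [sum_biUnion_sphere]
      refine (Finset.sum_le_sum fun k hk => ?_).trans
        (Finset.sum_le_sum_of_subset_of_nonneg (Finset.Ioc_subset_Ioc_right
          (Nat.pow_le_pow_right (by norm_num) (Nat.le_succ I)))
          fun _ _ _ => Finset.sum_nonneg fun _ _ => measureReal_nonneg)
      rw [Finset.mul_sum]
      refine Finset.sum_le_sum fun q hq => ?_
      rw [mem_sphere] at hq
      subst hq
      exact le_measureReal_reducedApproxSet hn ψ hψ (supNorm_pos.1 (Finset.mem_Ioc.1 hk).1)
    have h3 : K⁻¹ * (∑ q ∈ F I, f q - B₀) ≤ K⁻¹ * (K * ∑ k ∈ Finset.Ioc 0 (4 ^ I : ℕ),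
        ((k.totient : ℝ) / k) ^ m * ∑ q ∈ sphere n k, f q) := by
      gcongr
      have : B₀ = ∑ k ∈ Finset.Ioc 0 4, ∑ q ∈ sphere n k, f q :=
        Finset.sum_congr rfl fun k _ => hS k
      linarith
    rw [inv_mul_cancel_left₀ hK.ne'] at h3
    linarith
  have hdiv' : ∀ R : ℝ, ∃ I, R ≤ ∑ q ∈ F I, f q := by
    intro R
    rw [ENNReal.tsum_eq_iSup_sum, iSup_eq_top] at hdiv
    obtain ⟨G, hG⟩ := hdiv (ENNReal.ofReal (R + f 0)) ENNReal.ofReal_lt_top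
    have hG' : R + f 0 ≤ ∑ q ∈ G, f q := by
      have : ∑ q ∈ G, ∏ j, (ψ j q : ℝ≥0∞) = ENNReal.ofReal (∑ q ∈ G, f q) := by
        rw [ENNReal.ofReal_sum_of_nonneg fun q _ => hf0 q]
        refine Finset.sum_congr rfl fun q _ => ?_
        rw [hf, ENNReal.ofReal_prod_of_nonneg fun j _ => NNReal.coe_nonneg _]
        simp
      rw [this] at hG
      exact (ENNReal.ofReal_lt_ofReal_iff'.1 hG).1.le
    refine ⟨G.sup supNorm, ?_⟩
    have hsub : G ⊆ insert 0 (F (G.sup supNorm)) := by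
      intro q hq
      by_cases hq0 : q = 0
      · simp [hq0]
      · refine Finset.mem_insert_of_mem ?_
        simp only [F, Finset.mem_biUnion, Finset.mem_Ioc, mem_sphere]
        refine ⟨supNorm q, ⟨supNorm_pos.2 hq0, ?_⟩, rfl⟩
        calc supNorm q ≤ G.sup supNorm := Finset.le_sup (f := supNorm) hq
          _ ≤ G.sup supNorm + 1 := Nat.le_succ _
          _ ≤ 4 ^ (G.sup supNorm + 1) := (Nat.lt_pow_self (by norm_num)).le
    have h1 : ∑ q ∈ G, f q ≤ f 0 + ∑ q ∈ F (G.sup supNorm), f q := by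
      rw [← Finset.sum_insert fun h0 => hF _ 0 h0 rfl]
      exact Finset.sum_le_sum_of_subset_of_nonneg hsub fun q _ _ => hf0 q
    linarith
  -- Negation is the exceptional map: `q` and `-q` give strips around the same fibres.
  have hpos := measure_infinite_pos (μ := volume) (A := reducedApproxSet ψ)
    (measurableSet_reducedApproxSet ψ) (fun q => -q) hf0 (F := F) (K := 8 ^ m) (by positivity)
    (inv_pos.2 hK) (fun I q hq q' hq' h1 h2 =>
      measureReal_reducedApproxSet_inter_le ψ (hF I q hq) (hF I q' hq') (Ne.symm h1)
        fun h3 => h2 (by rw [h3, neg_neg])) hlow hdiv'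
  refine hpos.trans_le (measure_mono fun x hx => ?_)
  refine (hx.sdiff (finite_singleton 0)).mono fun q hq => ?_
  exact reducedApproxSet_subset ψ hq.2 hq.1

/-! ### The zero-one law -/

theorem tendsto_supNorm : Tendsto (supNorm : (Fin n → ℤ) → ℕ) cofinite atTop := by
  classical
  refine tendsto_atTop.2 fun b => eventually_cofinite.2 ?_
  refine ((Finset.range b).biUnion (sphere n)).finite_toSet.subset fun q hq => ?_
  simpa [mem_sphere] using hq

/-- The sum of the absolute values of the entries. -/
def sumNorm (q : Fin n → ℤ) : ℝ := ∑ i, |(q i : ℝ)|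

theorem supNorm_le_sumNorm (q : Fin n → ℤ) : (supNorm q : ℝ) ≤ sumNorm q := by
  rcases isEmpty_or_nonempty (Fin n) with h | h
  · simp [supNorm, sumNorm]
  obtain ⟨i, _, hi⟩ := Finset.exists_mem_eq_sup Finset.univ Finset.univ_nonempty
    fun i => (q i).natAbs
  rw [supNorm, hi, Nat.cast_natAbs, Int.cast_abs]
  exact Finset.single_le_sum (f := fun i => |(q i : ℝ)|) (fun i _ => abs_nonneg _)
    (Finset.mem_univ i)

theorem coe_sum_circle {ι : Type*} (s : Finset ι) (f : ι → ℝ) :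
    ((∑ i ∈ s, f i : ℝ) : UnitAddCircle) = ∑ i ∈ s, (f i : UnitAddCircle) :=
  map_sum (QuotientAddGroup.mk' (AddSubgroup.zmultiples (1 : ℝ))) f s

theorem norm_linForm_le (q : Fin n → ℤ) (x : Fin n → UnitAddCircle) :
    ‖linForm q x‖ ≤ sumNorm q * ‖x‖ := by
  rw [linForm_apply, sumNorm, Finset.sum_mul]
  refine norm_sum_le_of_le _ fun i _ => (norm_zsmul_le _ _).trans ?_
  rw [Int.norm_eq_abs]
  gcongr
  exact norm_le_pi_norm x i

theorem exists_coe_eq_abs_eq_norm (t : UnitAddCircle) :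
    ∃ r : ℝ, (r : UnitAddCircle) = t ∧ |r| = ‖t‖ := by
  obtain ⟨r, rfl⟩ := QuotientAddGroup.mk_surjective t
  refine ⟨r - round r, ?_, (UnitAddCircle.norm_eq).symm⟩
  have h0 : (((round r : ℤ) : ℝ) : UnitAddCircle) = 0 := by
    rw [AddCircle.coe_eq_zero_iff]; exact ⟨round r, by simp⟩
  rw [AddCircle.coe_sub, h0, sub_zero]

/-- Strips around the kernel of a linear form on the torus are metric neighbourhoods of it. -/
theorem thickening_ker_linForm {q : Fin n → ℤ} (hq : q ≠ 0) (δ : ℝ) :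
    thickening (δ / sumNorm q) {z | linForm q z = 0} = {z | ‖linForm q z‖ < δ} := by
  have hpos : 0 < sumNorm q := by
    refine lt_of_lt_of_le ?_ (supNorm_le_sumNorm q)
    exact_mod_cast supNorm_pos.2 hq
  ext z
  rw [mem_thickening_iff, mem_ofPred_eq]
  constructor
  · rintro ⟨w, hw, hzw⟩
    have h1 : linForm q z = linForm q (z - w) := by rw [map_sub, hw, sub_zero]
    rw [h1]
    refine (norm_linForm_le q _).trans_lt ?_
    rw [dist_eq_norm, lt_div_iff₀ hpos] at hzw
    linarith
  · intro hz
    obtain ⟨r, hr, hr'⟩ := exists_coe_eq_abs_eq_norm (linForm q z)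
    -- By duality of the `ℓ¹` and sup norms, this displacement changes the form by `r` at the least
    -- sup-norm cost, `|r| / sumNorm q`.
    let v : Fin n → UnitAddCircle := fun i => ((SignType.sign (q i : ℝ) * (r / sumNorm q) : ℝ))
    have hv : linForm q v = linForm q z := by
      rw [linForm_apply, ← hr]
      simp only [v, coe_zsmul_circle]
      rw [← coe_sum_circle]
      congr 1
      simp_rw [← mul_assoc, ← Finset.sum_mul, mul_comm ((q _ : ℤ) : ℝ) _, sign_mul_self]
      rw [← sumNorm]
      field_simp
    refine ⟨z - v, by rw [mem_ofPred_eq, map_sub, hv, sub_self], ?_⟩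
    rw [dist_eq_norm, sub_sub_cancel]
    have hlt : |r| / sumNorm q < δ / sumNorm q := by rw [hr']; gcongr
    refine lt_of_le_of_lt ((pi_norm_le_iff_of_nonneg (by positivity)).2 fun i => ?_) hlt
    simp only [v]
    rw [UnitAddCircle.norm_eq]
    refine (round_le _ 0).trans ?_
    rw [Int.cast_zero, sub_zero, abs_mul, abs_div, abs_of_pos hpos]
    refine mul_le_of_le_one_left (by positivity) ?_
    rcases lt_trichotomy (q i : ℝ) 0 with h | h | h <;> simp [h]

/-- Doubling the widths of a sequence of strips does not change the limsup set, up to a null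
set. -/
theorem setOf_infinite_linForm_lt_ae_eq (hn : 1 ≤ n) (Q : (Fin n → ℤ) → Prop)
    (δ : (Fin n → ℤ) → ℝ≥0) {C : ℝ≥0} (hδ : ∀ q, δ q ≤ C) :
    ({z | {q | Q q ∧ ‖linForm q z‖ < 2 * δ q}.Infinite} : Set (Fin n → UnitAddCircle)) =ᵐ[volume]
      {z | {q | Q q ∧ ‖linForm q z‖ < δ q}.Infinite} := by
  have : Nonempty (Fin n) := ⟨⟨0, hn⟩⟩
  obtain ⟨e⟩ : Nonempty (ℕ ≃ (Fin n → ℤ)) := by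
    obtain ⟨d⟩ := nonempty_denumerable (Fin n → ℤ)
    exact ⟨(Denumerable.eqv _).symm⟩
  let r : ℕ → ℝ := fun k => δ (e k) / sumNorm (e k)
  let s : ℕ → Set (Fin n → UnitAddCircle) := fun k => {z | linForm (e k) z = 0}
  -- Boundedness of the widths enters here: the radii must tend to 0 for
  -- `blimsup_thickening_mul_ae_eq`.
  have hr : Tendsto r atTop (𝓝 0) := by
    have h1 : Tendsto (fun k => sumNorm (e k)) atTop atTop := by
      refine tendsto_atTop_mono (fun k => supNorm_le_sumNorm (e k)) ?_
      refine tendsto_natCast_atTop_atTop.comp ?_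
      exact Nat.cofinite_eq_atTop ▸ tendsto_supNorm.comp e.injective.tendsto_cofinite
    have h2 : Tendsto (fun k => (C : ℝ) / sumNorm (e k)) atTop (𝓝 0) := h1.const_div_atTop _
    refine squeeze_zero (fun k => ?_) (fun k => ?_) h2
    · exact div_nonneg (NNReal.coe_nonneg _) (Finset.sum_nonneg fun i _ => abs_nonneg _)
    · refine div_le_div_of_nonneg_right ?_ (Finset.sum_nonneg fun i _ => abs_nonneg _)
      exact_mod_cast hδ (e k)
  -- The vector 0 has no strip description; dropping one index does not affect infinitude.
  let p : ℕ → Prop := fun k => Q (e k) ∧ e k ≠ 0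
  have hset : ∀ M : ℝ, blimsup (fun k => thickening (M * r k) (s k)) atTop p =
      {z | {q | Q q ∧ ‖linForm q z‖ < M * δ q}.Infinite} := by
    intro M
    rw [← Nat.cofinite_eq_atTop, cofinite.blimsup_set_eq]
    ext z
    have h1 : {k | p k ∧ z ∈ thickening (M * r k) (s k)} =
        e ⁻¹' ({q | Q q ∧ ‖linForm q z‖ < M * δ q} \ {0}) := by
      ext k
      simp only [p, r, s, mem_ofPred_eq, mem_preimage, Set.mem_sdiff, mem_singleton_iff]
      by_cases hk : e k = 0
      · simp [hk]
      · rw [← mul_div_assoc, thickening_ker_linForm hk, mem_ofPred_eq]; tauto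
    have h2 : ∀ A : Set (Fin n → ℤ), (e ⁻¹' (A \ {0})).Infinite ↔ A.Infinite := by
      intro A
      constructor
      · intro h
        refine (h.image e.injective.injOn).mono ?_
        rw [e.image_preimage]
        exact sdiff_subset
      · intro h
        exact (h.sdiff (finite_singleton 0)).preimage fun q _ => e.surjective q
    rw [mem_ofPred_eq, mem_ofPred_eq, h1, h2]
  have h := blimsup_thickening_mul_ae_eq (volume : Measure (Fin n → UnitAddCircle)) p s
    (M := 2) (by norm_num) r hr
  rw [hset 2] at h
  have h1 := hset 1
  simp only [one_mul] at h1
  rw [h1] at h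
  exact h

/-- By Fubini it suffices to vary column `j` alone. The other columns then merely select which `q`
are admitted, and the section is a limsup of strips in a single torus. -/
theorem limsupSet_update_ae_eq (hn : 1 ≤ n) {ψ : Fin m → (Fin n → ℤ) → ℝ≥0} {C : ℝ≥0}
    (hψ : ∀ j q, ψ j q ≤ C) (j : Fin m) :
    limsupSet (Function.update ψ j fun q => 2 * ψ j q) =ᵐ[volume] limsupSet ψ := by
  set ψ' := Function.update ψ j fun q => 2 * ψ j q with hψ'
  have hle : ∀ i q, ψ i q ≤ ψ' i q := by
    intro i q
    by_cases hi : i = j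
    · subst hi; rw [hψ', Function.update_self, two_mul]; exact le_add_self
    · rw [hψ', Function.update_of_ne hi]
  have hsub := limsupSet_mono hle
  have hD : volume (limsupSet ψ' \ limsupSet ψ) = 0 := by
    have hm := (measurableSet_limsupSet ψ').diff (measurableSet_limsupSet ψ)
    rw [← lintegral_indicator_one hm, volume_pi]
    have h0 : ∫⁻ _ : Fin m → Fin n → UnitAddCircle, (0 : ℝ≥0∞)
      ∂(Measure.pi fun _ => volume) = 0 := lintegral_zero
    rw [← h0]
    refine lintegral_eq_of_lmarginal_eq {j} (measurable_one.indicator hm) measurable_const ?_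
    rw [lmarginal_singleton, lmarginal_singleton]
    funext x
    rw [lintegral_zero]
    have hsec := setOf_infinite_linForm_lt_ae_eq hn
      (fun q => ∀ i, i ≠ j → ‖linForm q (x i)‖ < ψ i q) (ψ j) (hψ j)
    have hmem : ∀ (φ : Fin m → (Fin n → ℤ) → ℝ≥0) (z : Fin n → UnitAddCircle),
        Function.update x j z ∈ limsupSet φ ↔
          {q | (∀ i, i ≠ j → ‖linForm q (x i)‖ < φ i q) ∧ ‖linForm q z‖ < φ j q}.Infinite := by
      intro φ z
      rw [limsupSet, mem_ofPred_eq]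
      refine iff_of_eq (congrArg _ (Set.ext fun q => ?_))
      simp only [approxSet, mem_ofPred_eq]
      constructor
      · intro h
        refine ⟨fun i hi => ?_, ?_⟩
        · simpa [Function.update_of_ne hi] using h i
        · simpa using h j
      · rintro ⟨h1, h2⟩ i
        by_cases hi : i = j
        · subst hi; simpa using h2
        · simpa [Function.update_of_ne hi] using h1 i hi
    refine lintegral_eq_zero_of_ae_eq_zero ?_
    filter_upwards [hsec] with z hz
    rw [Pi.zero_apply, Set.indicator_of_notMem]
    rintro ⟨h1, h2⟩
    refine h2 ((hmem ψ z).2 ?_)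
    refine hz.mp ?_
    have h3 := (hmem ψ' z).1 h1
    refine h3.mono fun q hq => ⟨fun i hi => ?_, ?_⟩
    · have := hq.1 i hi
      rwa [hψ', Function.update_of_ne hi] at this
    · have := hq.2
      rw [hψ', Function.update_self] at this
      exact_mod_cast this
  exact (ae_le_set.2 hD).antisymm hsub.eventuallyLE

theorem limsupSet_two_mul_ae_eq (hn : 1 ≤ n) {ψ : Fin m → (Fin n → ℤ) → ℝ≥0} {C : ℝ≥0}
    (hψ : ∀ j q, ψ j q ≤ C) : limsupSet (fun j q => 2 * ψ j q) =ᵐ[volume] limsupSet ψ := by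
  have key : ∀ s : Finset (Fin m),
      limsupSet (fun j q => if j ∈ s then 2 * ψ j q else ψ j q) =ᵐ[volume] limsupSet ψ := by
    intro s
    induction s using Finset.induction_on with
    | empty => simp only [Finset.notMem_empty, if_false]; exact EventuallyEq.rfl
    | insert i s hi ih =>
      refine EventuallyEq.trans ?_ ih
      have hb : ∀ j q, (if j ∈ s then 2 * ψ j q else ψ j q) ≤ 2 * C := by
        intro j q
        have := hψ j q
        split_ifs
        · gcongr
        · exact this.trans (by rw [two_mul]; exact le_add_self)
      have h := limsupSet_update_ae_eq hn hb i
      have heq : (fun j q => if j ∈ insert i s then 2 * ψ j q else ψ j q) =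
          Function.update (fun j q => if j ∈ s then 2 * ψ j q else ψ j q) i
            fun q => 2 * if i ∈ s then 2 * ψ i q else ψ i q := by
        funext j q
        by_cases hj : j = i
        · subst hj; simp [hi]
        · simp [hj]
      rw [heq]
      exact h
  simpa using key Finset.univ

/-- The points killed by some power of 2 are the dyadic ones, which are dense; for a continuous
surjective endomorphism this gives ergodicity. -/
theorem ergodic_two_nsmul :
    Ergodic (fun x : Fin m → Fin n → UnitAddCircle => 2 • x) volume := by
  refine (nsmulAddMonoidHom (α := Fin m → Fin n → UnitAddCircle)
    2).ergodic_of_dense_iUnion_preimage_zero ?_ ?_ ?_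
  · intro x
    choose r hr using fun j i => QuotientAddGroup.mk_surjective (x j i)
    have hr : ∀ j i, ((r j i : ℝ) : UnitAddCircle) = x j i := hr
    refine mem_closure_of_tendsto (f := fun (k : ℕ) j i =>
      (((⌊(2 : ℝ) ^ k * r j i⌋ : ℝ) / 2 ^ k : ℝ) : UnitAddCircle)) (b := atTop) ?_ ?_
    · refine tendsto_pi_nhds.2 fun j => tendsto_pi_nhds.2 fun i => ?_
      rw [← hr j i]
      refine ((AddCircle.continuous_mk' (1 : ℝ)).tendsto _).comp ?_
      have hp : Tendsto (fun k : ℕ => ((1 : ℝ) / 2) ^ k) atTop (𝓝 0) :=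
        tendsto_pow_atTop_nhds_zero_of_lt_one (by norm_num) (by norm_num)
      refine tendsto_iff_dist_tendsto_zero.2 (squeeze_zero (fun _ => dist_nonneg) (fun k => ?_) hp)
      have h2 : (0 : ℝ) < 2 ^ k := by positivity
      rw [Real.dist_eq, abs_le, one_div, inv_pow]
      have hl := Int.floor_le ((2 : ℝ) ^ k * r j i)
      have hu := (Int.lt_floor_add_one ((2 : ℝ) ^ k * r j i)).le
      constructor
      · rw [neg_le_sub_iff_le_add, ← sub_nonneg]
        have : (⌊(2 : ℝ) ^ k * r j i⌋ : ℝ) / 2 ^ k + (2 ^ k)⁻¹ - r j i =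
          (⌊(2 : ℝ) ^ k * r j i⌋ + 1 - 2 ^ k * r j i) / 2 ^ k := by field_simp
        rw [this]
        exact div_nonneg (by linarith) h2.le
      · have : (⌊(2 : ℝ) ^ k * r j i⌋ : ℝ) / 2 ^ k ≤ r j i := by
          rw [div_le_iff₀ h2]; linarith
        have : (0 : ℝ) ≤ (2 ^ k)⁻¹ := by positivity
        linarith
    · refine Eventually.of_forall fun k => mem_iUnion.2 ⟨k, ?_⟩
      have hit : (⇑(nsmulAddMonoidHom (α := Fin m → Fin n → UnitAddCircle) 2))^[k] =
          fun x => 2 ^ k • x := by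
        change (fun x : Fin m → Fin n → UnitAddCircle => 2 • x)^[k] = _
        exact smul_iterate 2 k
      rw [hit, mem_preimage, Set.mem_zero]
      funext j i
      have h2 : (2 : ℝ) ^ k ≠ 0 := by positivity
      rw [Pi.smul_apply, Pi.smul_apply, ← AddCircle.coe_nsmul, nsmul_eq_mul, Nat.cast_pow,
        Nat.cast_ofNat, mul_div_cancel₀ _ h2, Pi.zero_apply, Pi.zero_apply,
        AddCircle.coe_eq_zero_iff]
      exact ⟨⌊(2 : ℝ) ^ k * r j i⌋, by simp⟩
  · exact continuous_const_smul 2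
  · intro x
    choose r hr using fun j i => QuotientAddGroup.mk_surjective (x j i)
    refine ⟨fun j i => ((r j i / 2 : ℝ) : UnitAddCircle), ?_⟩
    funext j i
    rw [← hr j i]
    change 2 • ((r j i / 2 : ℝ) : UnitAddCircle) = ((r j i : ℝ) : UnitAddCircle)
    rw [← AddCircle.coe_nsmul, nsmul_eq_mul, Nat.cast_ofNat, mul_div_cancel₀ _ two_ne_zero]

theorem add_self_mem_limsupSet {ψ : Fin m → (Fin n → ℤ) → ℝ≥0}
    {x : Fin m → Fin n → UnitAddCircle} (hx : x ∈ limsupSet ψ) :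
    x + x ∈ limsupSet fun j q => 2 * ψ j q := by
  refine hx.mono fun q hq j => ?_
  have h : ‖linForm q (x j)‖ < ψ j q := hq j
  rw [Pi.add_apply, map_add, NNReal.coe_mul, NNReal.coe_ofNat]
  have := norm_add_le (linForm q (x j)) (linForm q (x j))
  linarith

/-- A zero-one law for the limsup set. -/
theorem volume_limsupSet_eq_zero_or_one (hn : 1 ≤ n) {ψ : Fin m → (Fin n → ℤ) → ℝ≥0} {C : ℝ≥0}
    (hψ : ∀ j q, ψ j q ≤ C) : volume (limsupSet ψ) = 0 ∨ volume (limsupSet ψ) = 1 := by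
  have herg := ergodic_two_nsmul (n := n) (m := m)
  -- Together with `h2` this shows that the limsup set is almost contained in its own preimage under
  -- doubling.
  have h1 : limsupSet ψ ⊆ (fun x => 2 • x) ⁻¹' limsupSet (fun j q => 2 * ψ j q) := by
    intro x hx
    rw [mem_preimage, two_nsmul]
    exact add_self_mem_limsupSet hx
  have h2 : ((fun x => 2 • x) ⁻¹' limsupSet (fun j q => 2 * ψ j q) : Set _) =ᵐ[volume]
      (fun x => 2 • x) ⁻¹' limsupSet ψ :=
    herg.quasiMeasurePreserving.preimage_ae_eq (limsupSet_two_mul_ae_eq hn hψ)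
  rcases herg.ae_empty_or_univ_of_ae_le_preimage (measurableSet_limsupSet ψ).nullMeasurableSet
    (h1.eventuallyLE.trans h2.le) with h | h
  · left; rw [measure_congr h, measure_empty]
  · right; rw [measure_congr h, measure_univ]

/-! ### Return to the unit cube, and the two halves of the theorem -/

/-- The projection of real matrices onto the torus. -/
noncomputable def toTorus (x : Fin m → Fin n → ℝ) : Fin m → Fin n → UnitAddCircle :=
  fun j i => (x j i : UnitAddCircle)

theorem linForm_toTorus (q : Fin n → ℤ) (x : Fin m → Fin n → ℝ) (j : Fin m) :
    ‖linForm q (toTorus x j)‖ = distInt (∑ i, (q i : ℝ) * x j i) := by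
  rw [distInt, ← UnitAddCircle.norm_eq, linForm_apply, coe_sum_circle]
  simp only [toTorus, coe_zsmul_circle]

theorem volume_W (ψ : Fin m → (Fin n → ℤ) → ℝ≥0) : volume (W ψ) = volume (limsupSet ψ) := by
  set box : Set (Fin m → Fin n → ℝ) := Set.univ.pi fun _ => Set.univ.pi fun _ => Icc 0 1 with hbox
  have hW : W ψ = toTorus ⁻¹' limsupSet ψ ∩ box := by
    ext x
    simp only [W, limsupSet, approxSet, mem_inter_iff, mem_preimage, mem_ofPred_eq,
      linForm_toTorus, hbox, Set.mem_univ_pi]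
    exact and_comm
  have hboxm : MeasurableSet box :=
    MeasurableSet.univ_pi fun _ => MeasurableSet.univ_pi fun _ => measurableSet_Icc
  have hr : (volume : Measure (Fin m → Fin n → ℝ)).restrict box =
      Measure.pi fun _ => Measure.pi fun _ => volume.restrict (Ioc 0 (0 + 1)) := by
    rw [hbox, volume_pi, Measure.restrict_pi_pi]
    congr 1
    funext _
    rw [volume_pi, Measure.restrict_pi_pi]
    congr 1
    funext _
    rw [zero_add]
    exact (Measure.restrict_congr_set Ioc_ae_eq_Icc).symm
  have hmp : MeasurePreserving (toTorus (n := n) (m := m)) (volume.restrict box) volume := by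
    rw [hr]
    exact measurePreserving_pi _ _ fun _ => measurePreserving_pi _ _ fun _ =>
      UnitAddCircle.measurePreserving_mk 0
  rw [hW, ← Measure.restrict_apply' hboxm,
    hmp.measure_preimage (measurableSet_limsupSet ψ).nullMeasurableSet]

theorem volume_limsupSet_eq_zero {ψ : Fin m → (Fin n → ℤ) → ℝ≥0}
    (h : ∑' q : Fin n → ℤ, ∏ j, (ψ j q : ℝ≥0∞) < ∞) : volume (limsupSet ψ) = 0 := by
  classical
  -- The measure bound fails at `q = 0`, whose form vanishes identically; one index is harmless.
  let A : (Fin n → ℤ) → Set (Fin m → Fin n → UnitAddCircle) :=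
    fun q => if q = 0 then ∅ else approxSet ψ q
  have hA : ∑' q, volume (A q) ≠ ∞ := by
    refine ne_top_of_le_ne_top ?_ (ENNReal.tsum_le_tsum
      (g := fun q => 2 ^ m * ∏ j, (ψ j q : ℝ≥0∞)) fun q => ?_)
    · rw [ENNReal.tsum_mul_left]
      exact ENNReal.mul_ne_top (by finiteness) h.ne
    · simp only [A]
      split_ifs with hq
      · simp
      · exact volume_approxSet_le ψ hq
  refine measure_mono_null ?_ (measure_limsup_cofinite_eq_zero hA)
  rw [cofinite.limsup_set_eq]
  intro x hx
  refine (hx.sdiff (finite_singleton 0)).mono fun q hq => ?_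
  have hq0 : q ≠ 0 := hq.2
  simpa only [A, mem_ofPred_eq, if_neg hq0] using hq.1

theorem volume_limsupSet_eq_one_of_bounded (hn : 1 ≤ n) {ψ : Fin m → (Fin n → ℤ) → ℝ≥0} {C : ℝ≥0}
    (hψ : ∀ j q, ψ j q ≤ C) (hmono : NearlyMonotone ψ)
    (hdiv : ∑' q : Fin n → ℤ, ∏ j, (ψ j q : ℝ≥0∞) = ∞) : volume (limsupSet ψ) = 1 := by
  -- Scaling by `D⁻¹` makes all widths at most `1 / 2`, as disjointness of the balls requires,
  -- without increasing them. Positivity passes from `φ` up to `ψ`, to which the zero-one law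
  -- applies.
  set D : ℝ≥0 := 2 * (C + 1) with hD
  have hD0 : D ≠ 0 := by positivity
  let φ : Fin m → (Fin n → ℤ) → ℝ≥0 := fun j q => D⁻¹ * ψ j q
  have hφ : ∀ j q, φ j q ≤ 1 / 2 := by
    intro j q
    have h1 : ψ j q ≤ C + 1 := (hψ j q).trans le_self_add
    calc D⁻¹ * ψ j q ≤ D⁻¹ * (C + 1) := by gcongr
      _ = 1 / 2 := by rw [hD]; field_simp
  have hφψ : ∀ j q, φ j q ≤ ψ j q := by
    intro j q
    refine mul_le_of_le_one_left (zero_le) (inv_le_one_of_one_le₀ ?_)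
    rw [hD, two_mul]
    exact le_add_self.trans le_add_self
  have hprod : ∀ q, ∏ j, φ j q = D⁻¹ ^ m * ∏ j, ψ j q := by
    intro q; simp [φ, Finset.prod_mul_distrib]
  have hmonoφ : NearlyMonotone φ := by
    obtain ⟨α, c, hc, h⟩ := hmono
    refine ⟨α, c, hc, fun q₁ q₂ h1 h2 => ?_⟩
    have hs : ∀ k, (sphereSum φ k : ℝ) = (D⁻¹ ^ m : ℝ≥0) * (sphereSum ψ k : ℝ) := by
      intro k
      rw [← NNReal.coe_mul, sphereSum, sphereSum, Finset.mul_sum]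
      simp_rw [hprod]
    rw [hs, hs]
    calc _ = (D⁻¹ ^ m : ℝ≥0) * (c * ((q₂ : ℝ) ^ α * (sphereSum ψ q₂ : ℝ))) := by ring
      _ ≤ (D⁻¹ ^ m : ℝ≥0) * ((q₁ : ℝ) ^ α * (sphereSum ψ q₁ : ℝ)) :=
          mul_le_mul_of_nonneg_left (h q₁ q₂ h1 h2) (NNReal.coe_nonneg _)
      _ = _ := by ring
  have hdivφ : ∑' q : Fin n → ℤ, ∏ j, (φ j q : ℝ≥0∞) = ∞ := by
    have : ∀ q, ∏ j, (φ j q : ℝ≥0∞) = (D⁻¹ ^ m : ℝ≥0) * ∏ j, (ψ j q : ℝ≥0∞) := by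
      intro q
      have := congrArg ((↑) : ℝ≥0 → ℝ≥0∞) (hprod q)
      push_cast at this ⊢
      exact this
    simp_rw [this]
    rw [ENNReal.tsum_mul_left, hdiv, ENNReal.mul_top]
    exact_mod_cast pow_ne_zero m (inv_ne_zero hD0)
  have hpos := (volume_limsupSet_pos hn hmonoφ hφ hdivφ).trans_le
    (measure_mono (limsupSet_mono hφψ))
  exact (volume_limsupSet_eq_zero_or_one hn hψ).resolve_left hpos.ne'

/-- Distances to the nearest integer never exceed `1 / 2`, so a `q` with `ψ 0 q > 1 / 2` imposes no
condition. With more columns the others would still be constrained, hence the boundedness assumption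
for `m ≥ 2`. -/
theorem exists_bound_or_limsupSet_eq_univ (ψ : Fin 1 → (Fin n → ℤ) → ℝ≥0) :
    (∃ C : ℝ≥0, ∀ j q, ψ j q ≤ C) ∨ limsupSet ψ = univ := by
  by_cases h : {q | 1 / 2 < ψ 0 q}.Infinite
  · right
    refine eq_univ_of_forall fun x => h.mono fun q hq j => ?_
    obtain rfl : j = 0 := Subsingleton.elim _ _
    have h1 : ‖linForm q (x 0)‖ ≤ 1 / 2 := by
      simpa using AddCircle.norm_le_half_period (1 : ℝ) one_ne_zero (x := linForm q (x 0))
    exact h1.trans_lt (by exact_mod_cast hq)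
  · left
    rw [Set.not_infinite] at h
    refine ⟨1 / 2 + ∑ q ∈ h.toFinset, ψ 0 q, fun j q => ?_⟩
    obtain rfl : j = 0 := Subsingleton.elim _ _
    by_cases hq : 1 / 2 < ψ 0 q
    · exact (Finset.single_le_sum (f := ψ 0) (fun _ _ => zero_le)
        (h.mem_toFinset.2 hq)).trans le_add_self
    · exact (not_lt.1 hq).trans le_self_add

end WeightedApprox

theorem theorem1p3 (n m : ℕ) (hn : 1 ≤ n) (hm : 1 ≤ m)
    (ψ : Fin m → (Fin n → ℤ) → ℝ≥0) (hψ : WeightedApprox.NearlyMonotone ψ) :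
    (∑' q : Fin n → ℤ, ∏ j, (ψ j q : ℝ≥0∞) < ∞ →
      MeasureTheory.volume (WeightedApprox.W ψ) = 0) ∧
    ((2 ≤ m → ∃ C : ℝ≥0, ∀ j q, ψ j q ≤ C) →
      ∑' q : Fin n → ℤ, ∏ j, (ψ j q : ℝ≥0∞) = ∞ →
      MeasureTheory.volume (WeightedApprox.W ψ) = 1) := by
  rw [WeightedApprox.volume_W]
  refine ⟨WeightedApprox.volume_limsupSet_eq_zero, fun hb hdiv => ?_⟩
  rcases hm.eq_or_lt with rfl | h2
  · rcases WeightedApprox.exists_bound_or_limsupSet_eq_univ ψ with ⟨C, hC⟩ | h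
    · exact WeightedApprox.volume_limsupSet_eq_one_of_bounded hn hC hψ hdiv
    · rw [h, MeasureTheory.measure_univ]
  · obtain ⟨C, hC⟩ := hb h2
    exact WeightedApprox.volume_limsupSet_eq_one_of_bounded hn hC hψ hdiv
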